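/- **Notation.** Let $\mathbf k$ be a field. For a set $Z$ let $\mathfrak M(Z)$ be the free operated monoid on $Z$, with operator $u\mapsto\lfloor u\rfloor$: its elements are the words (including the empty word $1$) in letters $z\in Z$ and bracketed elements $\lfloor u\rfloor$, $u\in\mathfrak M(Z)$. Let $\mathbf k\mathfrak M(Z)$ be the free unital operated $\mathbf k$-algebra on $Z$. $\mathfrak M^\star(Z)$ is the set of elements of $\mathfrak M(Z\sqcup\{\star\})$ in which $\star$ occurs exactly once; $q|_u$ is $q$ with $\star$ replaced by $u$, extended linearly to $q|_s$ for $s\in\mathbf k\mathfrak M(Z)$. The breadth $|u|$ is the number of factors of $u$ from $Z\cup\lfloor\mathfrak M(Z)\rfloor$. A monomial order on $\mathfrak M(Z)$ is a well order (in particular linear) $\le$ with $u<v\Rightarrow q|_u<q|_v$ for all $u,v\in\mathfrak M(Z)$, $q\in\mathfrak M^\star(Z)$; $\bar f$ denotes the leading monomial of $f$ (and $\bar 0=1$). For $\mathcal G\subseteq\mathbf k\mathfrak M(Z)$, an element $h$ is trivial modulo $(\mathcal G,w)$ if $h=\sum_i c_i q_i|_{s_i}$ (a finite sum) with $c_i\in\mathbf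 k$, $s_i\in\mathcal G$, $q_i\in\mathfrak M^\star(Z)$, $q_i|_{\bar s_i}<w$. $\mathcal G$ is an operated Gröbner–Shirshov (GS) basis with respect to $\le$ if for all nonzero $f,g\in\mathcal G$, each divided by its leading coefficient, every intersection composition $fu-vg$ (where $w=\bar fu=v\bar g$, $\max\{|\bar f|,|\bar g|\}<|w|<|\bar f|+|\bar g|$) and every inclusion composition $f-q|_g$ (where $w=\bar f=q|_{\bar g}$) is trivial modulo $(\mathcal G,w)$. An operated polynomial identity $\phi\in\mathbf k\mathfrak M(\{x,y\})$ is *unital operated GS* on $\mathbf k\mathfrak M(Z)$ with respect to a monomial order $\le$ if the set of all its substitution instances $\phi(u,v)$, $u,v\in\mathfrak M(Z)$, is an operated GS basis with respect to $\le$. **Orders.** Let $Z$ be a well ordered set. Write $\deg_P(u)$ for the number of brackets in $u$. * $\le_{\rm db}$ on $\mathfrak M(Z)$: write $u=u_0\lfloor u_1^*\rfloor u_1\cdots\lfloor u_r^*\rfloor u_r$ with $u_i$ words in $Z$ and $u_i^*\in\mathfrak M(Z)$. Compare first $\deg_P(u)$, then $r$, then the tuple $(u_1^*,\dots,u_r^*,u_0,\dots,u_r)$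 lexicographically, where the $u_i^*$ are compared recursively by $\le_{\rm db}$ and the $u_i$ by the degree lexicographical order. * $\le_{\rm udl}$ on $\mathfrak M(Z)$: $1$ is the least element. For elements $\neq1$, regard every occurrence of $\lfloor1\rfloor$ as a new letter $\dagger$ smaller than all letters of $Z$ (so it is no longer counted as a bracket). Compare first $\deg_P$; then the number of occurrences of letters of $Z\sqcup\{\dagger\}$; then $\deg_G$, the sum over all half brackets of the number of letters to the left of that half bracket; finally the degree lexicographical order (by breadth, then lexicographically from the left), where letters are smaller than bracketed factors and bracketed factors are compared recursively by their contents. **Theorem.** Let $Z$ be a well ordered set. For all scalars $\lambda,\mu,\nu\in\mathbf k$, each of the following unital differential type OPIs is unital operated GS on $\mathbf k\mathfrak M(Z)$ with respect to one of the orders $\le_{\rm udl}$, $\le_{\rm db}$ (which are monomial orders), namely the one indicated: * $(U1'_a)$ $\lfloor x\rfloor\lfloor y\rfloor-\lambda(x\lfloor y\rfloor+\lfloor x\rfloor y)+\mu\lfloor xy\rfloor+\nu xy$ with $\lambda^2=\lambda\mu+\nu$: $\le_{\rm db}$; * $(U1'_b)=(U5'_a)$ $x\lfloor y\rfloor-\lfloor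 xy\rfloor+\lfloor x\rfloor y-\lambda xy$: $\le_{\rm udl}$; * $(U1'_c)=(U2'_b)=(U6'_b)$ $\lfloor x\rfloor-\lambda x$: $\le_{\rm db}$; * $(U2'_a)$ $\lfloor x\rfloor\lfloor y\rfloor-\lambda(x\lfloor y\rfloor+\lfloor x\rfloor y)+\mu\lfloor yx\rfloor+\lambda^2xy-\lambda\mu yx$: $\le_{\rm db}$; * $(U3')=(U4')=(U6'_a)$ $\lfloor x\rfloor+\lambda x\lfloor1\rfloor-(\lambda+1)\lfloor1\rfloor x$: $\le_{\rm udl}$; * $(U5'_b)$ $x\lfloor y\rfloor-\lfloor xy\rfloor+\lfloor x\rfloor y-x\lfloor1\rfloor y$: $\le_{\rm udl}$; * $(U5'_c)=(U6'_c)$ $x$: $\le_{\rm db}$. -/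

import Mathlib

/-! # Operated Gröbner–Shirshov bases in free unital operated algebras -/

noncomputable section

open Classical in
/-- An auxiliary choice: the element satisfying `p` if there is one, otherwise `d`. -/
def chooseOr {α : Type*} (p : α → Prop) (d : α) : α :=
  if h : ∃ a, p a then h.choose else d

/-- The free operated monoid `𝔐(Z)`.  Every element is uniquely a (possibly empty) word whose
letters are elements `z ∈ Z` or bracketed elements `⌊u⌋` with `u ∈ 𝔐(Z)`:
`one` is the empty word, `cons z w` is `z w`, and `brCons u w` is `⌊u⌋ w`. -/
inductive OpMon (Z : Type*) where
  | one : OpMon Z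
  | cons (z : Z) (w : OpMon Z) : OpMon Z
  | brCons (u w : OpMon Z) : OpMon Z

namespace OpMon

/-- Concatenation. -/
def append {Z : Type*} : OpMon Z → OpMon Z → OpMon Z
  | one, v => v
  | cons z w, v => cons z (append w v)
  | brCons u w, v => brCons u (append w v)

theorem append_one {Z : Type*} (u : OpMon Z) : append u one = u := by
  induction u with
  | one => rfl
  | cons z w ih => simp [append, ih]
  | brCons u w _ ih => simp [append, ih]

theorem append_assoc {Z : Type*} (u v w : OpMon Z) :
    append (append u v) w = append u (append v w) := by
  induction u with
  | one => rfl
  | cons z t ih => simp [append, ih]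
  | brCons s t _ ih => simp [append, ih]

instance instMonoid {Z : Type*} : Monoid (OpMon Z) where
  mul := append
  one := one
  mul_assoc := append_assoc
  one_mul _ := rfl
  mul_one := append_one

/-- The letter `z`, as an element of `𝔐(Z)`. -/
def var {Z : Type*} (z : Z) : OpMon Z := cons z one

/-- The operator `u ↦ ⌊u⌋` of `𝔐(Z)`. -/
def br {Z : Type*} (u : OpMon Z) : OpMon Z := brCons u one

/-- Substitution: the morphism of operated monoids `𝔐(X) → 𝔐(Z)` with `x ↦ f x`. -/
def subst {X Z : Type*} (f : X → OpMon Z) : OpMon X → OpMon Z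
  | one => 1
  | cons x w => f x * subst f w
  | brCons u w => br (subst f u) * subst f w

/-- The breadth `|u|`: the number of factors from `Z ∪ ⌊𝔐(Z)⌋` in `u`. -/
def breadth {Z : Type*} : OpMon Z → ℕ
  | one => 0
  | cons _ w => breadth w + 1
  | brCons _ w => breadth w + 1

/-- The `P`-degree: the number of brackets in `u`. -/
def degP {Z : Type*} : OpMon Z → ℕ
  | one => 0
  | cons _ w => degP w
  | brCons u w => degP u + 1 + degP w

/-- The degree in the letters: the number of occurrences of letters in `u`. -/
def degX {Z : Type*} : OpMon Z → ℕ
  | one => 0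
  | cons _ w => degX w + 1
  | brCons u w => degX u + degX w

/-- The sum of the `G`-degrees of the half brackets of `u`, if `c` letters stand to the left of `u`.
The `G`-degree of a half bracket is the number of letters to its left. -/
def degGFrom {Z : Type*} : ℕ → OpMon Z → ℕ
  | _, one => 0
  | c, cons _ w => degGFrom (c + 1) w
  | c, brCons u w => c + degGFrom c u + (c + degX u) + degGFrom (c + degX u) w

/-- The `G`-degree of `u`. -/
def degG {Z : Type*} (u : OpMon Z) : ℕ := degGFrom 0 u

/-- For `u = u₀⌊u₁*⌋u₁ ⋯ ⌊u_r*⌋u_r` with `u_i` words in `Z`, the list `[u₁*, …, u_r*]`. -/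
def brackets {Z : Type*} : OpMon Z → List (OpMon Z)
  | one => []
  | cons _ w => brackets w
  | brCons u w => u :: brackets w

/-- For `u = u₀⌊u₁*⌋u₁ ⋯ ⌊u_r*⌋u_r` with `u_i` words in `Z`, the list `[u₀, u₁, …, u_r]`. -/
def segments {Z : Type*} : OpMon Z → List (List Z)
  | one => [[]]
  | cons z w => (segments w).modifyHead (fun s => z :: s)
  | brCons _ w => [] :: segments w

/-- The `P`-breadth `|u|_P = r` of `u = u₀⌊u₁*⌋u₁ ⋯ ⌊u_r*⌋u_r`. -/
def breadthP {Z : Type*} (u : OpMon Z) : ℕ := (brackets u).length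

/-- Replace every occurrence of `⌊1⌋` by a new letter `† = ⊥`, which is smaller than all letters
of `Z`.  This identifies `𝔐(Z) \ {1}` with the free operated semigroup `𝔖(Z ⊔ {†})`, the set of
nonempty words in which no empty bracket occurs. -/
def dagger {Z : Type*} : OpMon Z → OpMon (WithBot Z)
  | one => one
  | cons z w => cons (z : WithBot Z) (dagger w)
  | brCons one w => cons ⊥ (dagger w)
  | brCons (cons z u) w => brCons (dagger (cons z u)) (dagger w)
  | brCons (brCons t u) w => brCons (dagger (brCons t u)) (dagger w)

end OpMon

/-- `𝔐^⋆(Z)`: the elements of `𝔐(Z ⊔ {⋆})` in which `⋆` occurs exactly once. -/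
inductive StarWord (Z : Type*) where
  /-- `⋆ w` -/
  | star (w : OpMon Z) : StarWord Z
  /-- `z q` -/
  | cons (z : Z) (q : StarWord Z) : StarWord Z
  /-- `⌊u⌋ q` -/
  | brCons (u : OpMon Z) (q : StarWord Z) : StarWord Z
  /-- `⌊q⌋ w` -/
  | inBr (q : StarWord Z) (w : OpMon Z) : StarWord Z

/-- `q|_u`: replace `⋆` in `q` by `u`. -/
def StarWord.plug {Z : Type*} : StarWord Z → OpMon Z → OpMon Z
  | star w, u => u * w
  | cons z q, u => OpMon.cons z (q.plug u)
  | brCons t q, u => OpMon.brCons t (q.plug u)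
  | inBr q w, u => OpMon.brCons (q.plug u) w

/-! ## Monomial orders -/

/-- `≤` is a monomial order on `𝔐(Z)`: a well order compatible with all `q ∈ 𝔐^⋆(Z)`. -/
structure IsMonomialOrder {Z : Type*} (le : OpMon Z → OpMon Z → Prop) : Prop where
  refl : ∀ u, le u u
  trans : ∀ u v w, le u v → le v w → le u w
  antisymm : ∀ u v, le u v → le v u → u = v
  total : ∀ u v, le u v ∨ le v u
  wf : WellFounded fun u v => le u v ∧ u ≠ v
  plug_lt : ∀ (q : StarWord Z) (u v : OpMon Z), le u v → u ≠ v →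
    le (q.plug u) (q.plug v) ∧ q.plug u ≠ q.plug v

/-- The strict order `<_db`: compare the `P`-degrees, then the `P`-breadths, then
lexicographically `(u₁*, …, u_r*, u₀, …, u_r)`, where the `u_i*` are compared recursively by
`<_db` and the words `u_i` in `Z` by the degree lexicographical order. -/
inductive DbLt {Z : Type*} [LinearOrder Z] : OpMon Z → OpMon Z → Prop where
  | degP {u v : OpMon Z} : u.degP < v.degP → DbLt u v
  | breadthP {u v : OpMon Z} : u.degP = v.degP → u.breadthP < v.breadthP → DbLt u v
  | brackets {u v a b : OpMon Z} {l s t : List (OpMon Z)} :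
      u.degP = v.degP → u.breadthP = v.breadthP →
      u.brackets = l ++ a :: s → v.brackets = l ++ b :: t → DbLt a b → DbLt u v
  | segments {u v : OpMon Z} : u.degP = v.degP → u.breadthP = v.breadthP →
      u.brackets = v.brackets →
      List.Lex (List.Shortlex (fun a b : Z => a < b)) u.segments v.segments → DbLt u v

/-- The order `≤_db` on `𝔐(Z)`. -/
def DbLe {Z : Type*} [LinearOrder Z] (u v : OpMon Z) : Prop := u = v ∨ DbLt u v

/-- The strict order `<_Dlex`: the degree lexicographical order on words in the alphabet
`Y ⊔ ⌊𝔖(Y)⌋`, where all `y ∈ Y` are smaller than all brackets, and brackets are compared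
recursively by their contents. -/
inductive DlexLt {Y : Type*} [LinearOrder Y] : OpMon Y → OpMon Y → Prop where
  | breadth {u v : OpMon Y} : u.breadth < v.breadth → DlexLt u v
  | letter {u v p s t : OpMon Y} {a b : Y} : u.breadth = v.breadth →
      u = p * OpMon.var a * s → v = p * OpMon.var b * t → a < b → DlexLt u v
  | letterBr {u v p s t b : OpMon Y} {a : Y} : u.breadth = v.breadth →
      u = p * OpMon.var a * s → v = p * OpMon.br b * t → DlexLt u v
  | br {u v p s t a b : OpMon Y} : u.breadth = v.breadth →
      u = p * OpMon.br a * s → v = p * OpMon.br b * t → DlexLt a b → DlexLt u v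

/-- The strict order `<_dl` on `𝔖(Y)`: compare the `P`-degrees, then the degrees in the letters,
then the `G`-degrees, then by `<_Dlex`.  (The formula is used on elements of `𝔖(Y)` only.) -/
def DlLt {Y : Type*} [LinearOrder Y] (u v : OpMon Y) : Prop :=
  u.degP < v.degP ∨ (u.degP = v.degP ∧ (u.degX < v.degX ∨ (u.degX = v.degX ∧
    (u.degG < v.degG ∨ (u.degG = v.degG ∧ DlexLt u v)))))

/-- The order `≤_udl` on `𝔐(Z) = 𝔖(Z ⊔ {†}) ⊔ {1}`: it is `≤_dl` on `𝔖(Z ⊔ {†})`, and `1` is the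
least element. -/
def UdlLe {Z : Type*} [LinearOrder Z] (u v : OpMon Z) : Prop :=
  u = v ∨ (u = 1 ∧ v ≠ 1) ∨ (u ≠ 1 ∧ v ≠ 1 ∧ DlLt u.dagger v.dagger)

/-! ## Operated polynomials and Gröbner–Shirshov bases -/

/-- `𝐤𝔐(Z)`, the free unital operated algebra. -/
abbrev OpPoly (k : Type*) [Field k] (Z : Type*) := MonoidAlgebra k (OpMon Z)

/-- The monomial `u` as an element of `𝐤𝔐(Z)`. -/
def mon (k : Type*) [Field k] {Z : Type*} (u : OpMon Z) : OpPoly k Z := MonoidAlgebra.single u 1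

/-- `q|_s` for `q ∈ 𝔐^⋆(Z)` and `s ∈ 𝐤𝔐(Z)`, by linearity. -/
def StarWord.plugPoly {k : Type*} [Field k] {Z : Type*} (q : StarWord Z) (s : OpPoly k Z) :
    OpPoly k Z := MonoidAlgebra.mapDomain q.plug s

/-- `φ(u)` for an operated polynomial `φ ∈ 𝐤𝔐(X)` and a family `u` of elements of `𝔐(Z)`. -/
def OpPoly.substPoly {k : Type*} [Field k] {X Z : Type*} (u : X → OpMon Z) (φ : OpPoly k X) :
    OpPoly k Z := MonoidAlgebra.mapDomain (OpMon.subst u) φ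

/-- `S_Φ(Y)`: all `φ(u)` with `φ ∈ Φ` and all entries of `u` in `Y`. -/
def substSet {k : Type*} [Field k] {X Z : Type*} (Φ : Set (OpPoly k X)) (Y : Set (OpMon Z)) :
    Set (OpPoly k Z) :=
  {f | ∃ φ ∈ Φ, ∃ u : X → OpMon Z, (∀ x, u x ∈ Y) ∧ f = OpPoly.substPoly u φ}

/-- The leading monomial of `f`: the largest monomial that appears in `f`, and `1` if `f = 0`. -/
def leadMon {k : Type*} [Field k] {Z : Type*} (le : OpMon Z → OpMon Z → Prop) (f : OpPoly k Z) :
    OpMon Z :=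
  chooseOr (fun m => m ∈ f.coeff.support ∧ ∀ n ∈ f.coeff.support, le n m) 1

/-- `f` divided by its leading coefficient. -/
def monicize {k : Type*} [Field k] {Z : Type*} (le : OpMon Z → OpMon Z → Prop) (f : OpPoly k Z) :
    OpPoly k Z := (f.coeff (leadMon le f))⁻¹ • f

/-- `f` is trivial modulo `(G, w)`: it is a linear combination of elements `q|_s` with
`q ∈ 𝔐^⋆(Z)`, `s ∈ G` and `q|_s̄ < w`. -/
def IsTrivialMod {k : Type*} [Field k] {Z : Type*} (le : OpMon Z → OpMon Z → Prop)
    (G : Set (OpPoly k Z)) (w : OpMon Z) (f : OpPoly k Z) : Prop :=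
  f ∈ Submodule.span k {h : OpPoly k Z | ∃ (q : StarWord Z) (s : OpPoly k Z), s ∈ G ∧
    le (q.plug (leadMon le s)) w ∧ q.plug (leadMon le s) ≠ w ∧ h = q.plugPoly s}

/-- All intersection compositions and all inclusion compositions of the monic polynomials `f`, `g`
are trivial modulo `G`. -/
def CompositionsTrivial {k : Type*} [Field k] {Z : Type*} (le : OpMon Z → OpMon Z → Prop)
    (G : Set (OpPoly k Z)) (f g : OpPoly k Z) : Prop :=
  (∀ w u v : OpMon Z, w = leadMon le f * u → w = v * leadMon le g →
    max (leadMon le f).breadth (leadMon le g).breadth < w.breadth →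
    w.breadth < (leadMon le f).breadth + (leadMon le g).breadth →
    IsTrivialMod le G w (f * mon k u - mon k v * g)) ∧
  (∀ (w : OpMon Z) (q : StarWord Z), w = leadMon le f → w = q.plug (leadMon le g) →
    IsTrivialMod le G w (f - q.plugPoly g))

/-- `G` is an operated Gröbner–Shirshov basis in `𝐤𝔐(Z)` with respect to `≤`. -/
def IsOperatedGSBasis {k : Type*} [Field k] {Z : Type*} (le : OpMon Z → OpMon Z → Prop)
    (G : Set (OpPoly k Z)) : Prop :=
  ∀ f ∈ G, ∀ g ∈ G, f ≠ 0 → g ≠ 0 → CompositionsTrivial le G (monicize le f) (monicize le g)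

/-- The family `Φ ⊆ 𝐤𝔐(X)` of operated polynomial identities is Gröbner–Shirshov on `𝐤𝔐(Z)` with
respect to the monomial order `≤`. -/
def IsGSOn {k : Type*} [Field k] {X Z : Type*} (le : OpMon Z → OpMon Z → Prop)
    (Φ : Set (OpPoly k X)) : Prop :=
  IsMonomialOrder le ∧ IsOperatedGSBasis le (substSet Φ (Set.univ : Set (OpMon Z)))

/-! ## The operated polynomial identities of unital differential type -/

namespace UDiff

open OpMon

/-- The variable `x` of `X = {x, y}`. -/
def x : OpMon (Fin 2) := var 0

/-- The variable `y` of `X = {x, y}`. -/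
def y : OpMon (Fin 2) := var 1

/-- `(U1'_a)`: `⌊x⌋⌊y⌋ - a (x⌊y⌋ + ⌊x⌋y) + b ⌊xy⌋ + c xy`, to be used with `a² = a b + c`. -/
def U1a {k : Type*} [Field k] (a b c : k) : OpPoly k (Fin 2) :=
  mon k (br x * br y) - a • (mon k (x * br y) + mon k (br x * y)) + b • mon k (br (x * y))
    + c • mon k (x * y)

/-- `(U1'_b) = (U5'_a)`: `x⌊y⌋ - ⌊xy⌋ + ⌊x⌋y - a xy`. -/
def U1b {k : Type*} [Field k] (a : k) : OpPoly k (Fin 2) :=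
  mon k (x * br y) - mon k (br (x * y)) + mon k (br x * y) - a • mon k (x * y)

/-- `(U1'_c) = (U2'_b) = (U6'_b)`: `⌊x⌋ - a x`. -/
def U1c {k : Type*} [Field k] (a : k) : OpPoly k (Fin 2) :=
  mon k (br x) - a • mon k x

/-- `(U2'_a)`: `⌊x⌋⌊y⌋ - a (x⌊y⌋ + ⌊x⌋y) + b ⌊yx⌋ + a² xy - a b yx`. -/
def U2a {k : Type*} [Field k] (a b : k) : OpPoly k (Fin 2) :=
  mon k (br x * br y) - a • (mon k (x * br y) + mon k (br x * y)) + b • mon k (br (y * x))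
    + a ^ 2 • mon k (x * y) - (a * b) • mon k (y * x)

/-- `(U3') = (U4') = (U6'_a)`: `⌊x⌋ + a x⌊1⌋ - (a + 1) ⌊1⌋x`. -/
def U3 {k : Type*} [Field k] (a : k) : OpPoly k (Fin 2) :=
  mon k (br x) + a • mon k (x * br 1) - (a + 1) • mon k (br 1 * x)

/-- `(U5'_b)`: `x⌊y⌋ - ⌊xy⌋ + ⌊x⌋y - x⌊1⌋y`. -/
def U5b (k : Type*) [Field k] : OpPoly k (Fin 2) :=
  mon k (x * br y) - mon k (br (x * y)) + mon k (br x * y) - mon k (x * br 1 * y)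

/-- `(U5'_c) = (U6'_c)`: `x`. -/
def U5c (k : Type*) [Field k] : OpPoly k (Fin 2) := mon k x

end UDiff

end

/-! Both orders are lexicographic products of well-founded comparisons. Their recursive stages look
only at contents of brackets, which have smaller $P$-degree, so totality and well-foundedness follow
by induction on the $P$-degree. For $\le_{\rm udl}$ this is done after $\lfloor1\rfloor$ has become
a letter.

For an occurrence strictly inside an argument, one principle (`sub_plugLin_mem_idealLT`) serves all
the rules. Each identity is multilinear, so an argument $q|_{\bar g}$ may be replaced by $q|_g$ up
to instances with smaller leading monomial. The non-leading terms at $q|_g$ are then multiples of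
$q|_g$ below $w$. What remains are proper overlaps of leading words, each governed by one algebraic
identity.

For leading monomial $\lfloor u\rfloor$ there are no proper overlaps. For leading monomial $\lfloor
u\rfloor\lfloor v\rfloor$, put $D=\lfloor\cdot\rfloor-\lambda$. The rule reads $f(X,Y)=D(X)D(Y)+\mu
D(X\circ Y)$ with $\circ$ the product or the opposite product. Associativity of $\circ$ gives
$f(X,Y)D(W)-D(X)f(Y,W)=\mu f(X\circ Y,W)-\mu f(X,Y\circ W)$, and every term that results has fewer
brackets than $\lfloor X\rfloor\lfloor Y\rfloor\lfloor W\rfloor$.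

For leading monomial $u\lfloor v\rfloor$, the rule $f(X,Y)=X\lfloor Y\rfloor-\lfloor
XY\rfloor+\lfloor X\rfloor Y-XEY$ is a Hochschild 2-cocycle: $Bf(S,T)-f(BS,T)+f(B,ST)-f(B,S)T=0$.
This settles the inclusions at the end of the word and, combined with one reduction by $f$, the
intersections (`derivRule_inclusion`, `derivRule_intersection`). Instances with an argument $1$
vanish for $E=\lfloor1\rfloor$. For $E=\lambda$ they are multiples of $\lfloor1\rfloor-\lambda$,
whose compositions need the separate lemma `plugLin_sub_plugLin_mem_idealLT`. -/

noncomputable section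

/-! ### Words as lists of factors; Levi's lemma. -/

namespace OpMon

variable {Z : Type*}

@[simp] theorem one_def : (one : OpMon Z) = 1 := rfl

@[simp] theorem cons_mul (z : Z) (u v : OpMon Z) : cons z u * v = cons z (u * v) := rfl

@[simp] theorem brCons_mul (t u v : OpMon Z) : brCons t u * v = brCons t (u * v) := rfl

@[simp] theorem var_mul (z : Z) (u : OpMon Z) : var z * u = cons z u := rfl

@[simp] theorem br_mul (t u : OpMon Z) : br t * u = brCons t u := rfl

-- The base case is phrased with the unit `1`, so that the monoid simp lemmas apply in inductions.
@[elab_as_elim, induction_eliminator]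
theorem rec_mul {motive : OpMon Z → Prop} (one : motive 1)
    (cons : ∀ z w, motive w → motive (cons z w))
    (brCons : ∀ u w, motive u → motive w → motive (brCons u w)) (u : OpMon Z) : motive u :=
  OpMon.rec one cons brCons u

@[simp] theorem cons_ne_one (z : Z) (u : OpMon Z) : cons z u ≠ 1 := nofun

@[simp] theorem brCons_ne_one (t u : OpMon Z) : brCons t u ≠ 1 := nofun

@[simp] theorem br_ne_one (t : OpMon Z) : br t ≠ 1 := nofun

/-- The list of factors of `u` from `Z ∪ ⌊𝔐(Z)⌋`. -/
def factors : OpMon Z → List (Z ⊕ OpMon Z)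
  | one => []
  | cons z w => Sum.inl z :: factors w
  | brCons u w => Sum.inr u :: factors w

@[simp] theorem factors_one : factors (1 : OpMon Z) = [] := rfl
@[simp] theorem factors_cons (z : Z) (w : OpMon Z) :
    factors (cons z w) = Sum.inl z :: factors w := rfl
@[simp] theorem factors_brCons (u w : OpMon Z) :
    factors (brCons u w) = Sum.inr u :: factors w := rfl

@[simp] theorem factors_mul (u v : OpMon Z) : factors (u * v) = factors u ++ factors v := by
  induction u with
  | one => simp
  | cons z w ih => simp [ih]
  | brCons t w _ ih => simp [ih]

theorem factors_injective : Function.Injective (factors (Z := Z)) := by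
  intro u
  induction u with
  | one => intro v h; cases v <;> simp_all [factors]
  | cons z w ih =>
    intro v h
    cases v <;> simp [factors] at h
    simp [h.1, ih h.2]
  | brCons t w _ ih =>
    intro v h
    cases v <;> simp [factors] at h
    simp [h.1, ih h.2]

theorem factors_surjective : Function.Surjective (factors (Z := Z)) := by
  intro l
  induction l with
  | nil => exact ⟨1, rfl⟩
  | cons a l ih =>
    obtain ⟨w, rfl⟩ := ih
    cases a with
    | inl z => exact ⟨cons z w, rfl⟩
    | inr u => exact ⟨brCons u w, rfl⟩

theorem length_factors (u : OpMon Z) : (factors u).length = u.breadth := by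
  induction u with
  | one => rfl
  | cons z w ih => simp [breadth, ih]
  | brCons t w _ ih => simp [breadth, ih]

@[simp] theorem breadth_one : breadth (1 : OpMon Z) = 0 := rfl
@[simp] theorem breadth_cons (z : Z) (w : OpMon Z) : breadth (cons z w) = breadth w + 1 := rfl
@[simp] theorem breadth_brCons (u w : OpMon Z) : breadth (brCons u w) = breadth w + 1 := rfl
@[simp] theorem breadth_br (u : OpMon Z) : breadth (br u) = 1 := rfl

@[simp] theorem breadth_mul (u v : OpMon Z) : breadth (u * v) = breadth u + breadth v := by
  simp [← length_factors]

theorem breadth_eq_zero {u : OpMon Z} : breadth u = 0 ↔ u = 1 := by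
  cases u <;> simp

theorem mul_eq_one {u v : OpMon Z} : u * v = 1 ↔ u = 1 ∧ v = 1 := by
  simp [← breadth_eq_zero]

/-- Levi's lemma. -/
theorem mul_eq_mul_iff {a b c d : OpMon Z} (h : a * c = b * d) :
    (∃ e, b = a * e ∧ c = e * d) ∨ ∃ e, a = b * e ∧ d = e * c := by
  have h := congrArg factors h
  simp only [factors_mul] at h
  rcases List.append_eq_append_iff.1 h with ⟨l, h1, h2⟩ | ⟨l, h1, h2⟩ <;>
    obtain ⟨e, rfl⟩ := factors_surjective l
  · exact .inl ⟨e, factors_injective (by simp [h1]), factors_injective (by simp [h2])⟩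
  · exact .inr ⟨e, factors_injective (by simp [h1]), factors_injective (by simp [h2])⟩

/-- Comparing breadths decides which alternative of Levi's lemma occurs. -/
theorem exists_suffix {a b c d : OpMon Z} (h : a * c = b * d) (hl : c.breadth ≤ d.breadth) :
    ∃ e, a = b * e ∧ d = e * c := by
  rcases mul_eq_mul_iff h with ⟨e, rfl, rfl⟩ | h
  · have : e = 1 := breadth_eq_zero.1 (by simp at hl; omega)
    subst this
    exact ⟨1, by simp, by simp⟩
  · exact h

theorem br_injective : Function.Injective (br (Z := Z)) := fun _ _ h => (brCons.inj h).1

@[simp] theorem degP_one : degP (1 : OpMon Z) = 0 := rfl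
@[simp] theorem degP_cons (z : Z) (w : OpMon Z) : degP (cons z w) = degP w := rfl
@[simp] theorem degP_brCons (u w : OpMon Z) : degP (brCons u w) = degP u + 1 + degP w := rfl
@[simp] theorem degP_br (u : OpMon Z) : degP (br u) = degP u + 1 := rfl

@[simp] theorem degP_mul (u v : OpMon Z) : degP (u * v) = degP u + degP v := by
  induction u with
  | one => simp
  | cons z w ih => simp [ih]
  | brCons t w _ ih => simp [ih]; omega

end OpMon

open OpMon

/-! ### Contexts, and the relative position of two occurrences. -/

namespace StarWord

variable {Z : Type*}

@[simp] theorem plug_star (w u : OpMon Z) : (star w).plug u = u * w := rfl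
@[simp] theorem plug_cons (z : Z) (q : StarWord Z) (u : OpMon Z) :
    (cons z q).plug u = OpMon.cons z (q.plug u) := rfl
@[simp] theorem plug_brCons (t : OpMon Z) (q : StarWord Z) (u : OpMon Z) :
    (brCons t q).plug u = OpMon.brCons t (q.plug u) := rfl
@[simp] theorem plug_inBr (q : StarWord Z) (w u : OpMon Z) :
    (inBr q w).plug u = OpMon.brCons (q.plug u) w := rfl

/-- The product `u q`. -/
def lmul : OpMon Z → StarWord Z → StarWord Z
  | .one, q => q
  | .cons z u, q => cons z (lmul u q)
  | .brCons t u, q => brCons t (lmul u q)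

/-- The product `q v`. -/
def rmul : StarWord Z → OpMon Z → StarWord Z
  | star w, v => star (w * v)
  | cons z q, v => cons z (rmul q v)
  | brCons t q, v => brCons t (rmul q v)
  | inBr q w, v => inBr q (w * v)

/-- The composition of contexts. -/
def comp : StarWord Z → StarWord Z → StarWord Z
  | star w, r => rmul r w
  | cons z q, r => cons z (comp q r)
  | brCons t q, r => brCons t (comp q r)
  | inBr q w, r => inBr (comp q r) w

@[simp] theorem plug_lmul (a : OpMon Z) (q : StarWord Z) (u : OpMon Z) :
    (lmul a q).plug u = a * q.plug u := by
  induction a with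
  | one => rfl
  | cons z w ih => simp [lmul, ih]
  | brCons t w _ ih => simp [lmul, ih]

@[simp] theorem plug_rmul (q : StarWord Z) (b u : OpMon Z) :
    (rmul q b).plug u = q.plug u * b := by
  induction q with
  | star w => simp [rmul, mul_assoc]
  | cons z q ih => simp [rmul, ih]
  | brCons t q ih => simp [rmul, ih]
  | inBr q w ih => simp [rmul]

@[simp] theorem plug_comp (q r : StarWord Z) (u : OpMon Z) :
    (comp q r).plug u = q.plug (r.plug u) := by
  induction q with
  | star w => simp [comp]
  | cons z q ih => simp [comp, ih]
  | brCons t q ih => simp [comp, ih]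
  | inBr q w ih => simp [comp, ih]

theorem eq_one_of_plug_eq_one {q : StarWord Z} {s : OpMon Z} (h : q.plug s = 1) : s = 1 := by
  cases q with
  | star w => exact (mul_eq_one.1 h).1
  | cons z q => simp at h
  | brCons t q => simp at h
  | inBr q w => simp at h

/-- An occurrence of `s ≠ 1` in a bracket is the whole bracket or lies inside it. -/
theorem plug_eq_br {q : StarWord Z} {s u : OpMon Z} (hs : s ≠ 1) (h : q.plug s = br u) :
    (s = br u ∧ ∀ x, q.plug x = x) ∨
      ∃ q' : StarWord Z, q'.plug s = u ∧ ∀ x, q.plug x = br (q'.plug x) := by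
  cases q with
  | star w =>
    have hb := congrArg breadth h
    have hs' : breadth s ≠ 0 := mt breadth_eq_zero.1 hs
    simp only [plug_star, breadth_mul, breadth_br] at hb
    obtain rfl : w = 1 := breadth_eq_zero.1 (by omega)
    exact .inl ⟨by simpa using h, by simp⟩
  | cons z q => exact nomatch h
  | brCons t q => exact absurd (eq_one_of_plug_eq_one (OpMon.brCons.inj h).2) hs
  | inBr q w =>
    obtain ⟨h1, rfl⟩ := OpMon.brCons.inj h
    exact .inr ⟨q, h1, fun x => rfl⟩

/-- An occurrence of `s ≠ 1` in `u v` lies in `u`, or in `v`, or is a product of nonempty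
suffix of `u` and a nonempty prefix of `v`. -/
theorem plug_eq_mul {q : StarWord Z} {s u v : OpMon Z} (hs : s ≠ 1) (h : q.plug s = u * v) :
    (∃ q' : StarWord Z, q'.plug s = u ∧ ∀ x, q.plug x = q'.plug x * v) ∨
    (∃ q' : StarWord Z, q'.plug s = v ∧ ∀ x, q.plug x = u * q'.plug x) ∨
    ∃ b s₁ s₂ c : OpMon Z, s₁ ≠ 1 ∧ s₂ ≠ 1 ∧ s = s₁ * s₂ ∧ u = b * s₁ ∧ v = s₂ * c ∧
      ∀ x, q.plug x = b * x * c := by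
  induction u generalizing q with
  | one => exact .inr (.inl ⟨q, by simpa using h, by simp⟩)
  | cons z w ih =>
    cases q with
    | star c =>
      rcases mul_eq_mul_iff (a := s) (c := c) h with ⟨e, h1, rfl⟩ | ⟨e, rfl, rfl⟩
      · exact .inl ⟨star e, h1.symm, by simp [mul_assoc]⟩
      · by_cases he : e = 1
        · subst he
          exact .inl ⟨star 1, by simp, by simp⟩
        · exact .inr (.inr ⟨1, _, e, c, by simp, he, rfl, by simp, rfl, by simp⟩)
    | cons z' q =>
      obtain ⟨rfl, h'⟩ := OpMon.cons.inj h
      rcases ih h' with ⟨q', h1, h2⟩ | ⟨q', h1, h2⟩ | ⟨b, s₁, s₂, c, h1, h2, h3, h4, h5, h6⟩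
      · exact .inl ⟨cons z' q', by simp [h1], by simp [h2]⟩
      · exact .inr (.inl ⟨q', h1, by simp [h2]⟩)
      · exact .inr (.inr ⟨.cons z' b, s₁, s₂, c, h1, h2, h3, by simp [h4], h5, by simp [h6]⟩)
    | brCons t q => exact nomatch h
    | inBr q w => exact nomatch h
  | brCons t w _ ih =>
    cases q with
    | star c =>
      rcases mul_eq_mul_iff (a := s) (c := c) h with ⟨e, h1, rfl⟩ | ⟨e, rfl, rfl⟩
      · exact .inl ⟨star e, h1.symm, by simp [mul_assoc]⟩
      · by_cases he : e = 1
        · subst he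
          exact .inl ⟨star 1, by simp, by simp⟩
        · exact .inr (.inr ⟨1, _, e, c, by simp, he, rfl, by simp, rfl, by simp⟩)
    | cons z' q => exact nomatch h
    | brCons t' q =>
      obtain ⟨rfl, h'⟩ := OpMon.brCons.inj h
      rcases ih h' with ⟨q', h1, h2⟩ | ⟨q', h1, h2⟩ | ⟨b, s₁, s₂, c, h1, h2, h3, h4, h5, h6⟩
      · exact .inl ⟨brCons t' q', by simp [h1], by simp [h2]⟩
      · exact .inr (.inl ⟨q', h1, by simp [h2]⟩)
      · exact .inr (.inr ⟨.brCons t' b, s₁, s₂, c, h1, h2, h3, by simp [h4], h5, by simp [h6]⟩)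
    | inBr q c =>
      obtain ⟨h1, rfl⟩ := OpMon.brCons.inj h
      exact .inl ⟨inBr q w, by simp [h1], fun x => rfl⟩

/-- Two occurrences, of `s ≠ 1` and of a bracket, in the same element: the bracket lies in `s`,
or the occurrences are disjoint, or `s` lies in the bracket. -/
theorem plug_eq_plug_br {q₁ q₂ : StarWord Z} {s : OpMon Z} (hs : s ≠ 1)
    (h : q₁.plug s = q₂.plug (br 1)) :
    (∃ q' : StarWord Z, s = q'.plug (br 1) ∧ ∀ x, q₂.plug x = q₁.plug (q'.plug x)) ∨
    ∃ r₁ r₂ : OpMon Z → StarWord Z, (∀ x y, (r₁ y).plug x = (r₂ x).plug y) ∧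
      (∀ x, q₁.plug x = (r₁ (br 1)).plug x) ∧ ∀ y, q₂.plug y = (r₂ s).plug y := by
  -- In the disjoint case `r₁` and `r₂` encode one word with two holes: `(r₁ y).plug x = (r₂ x).plug
  -- y` has `x` in the first hole and `y` in the second.
  induction q₁ generalizing q₂ with
  | star w =>
    rcases plug_eq_mul (br_ne_one _) h.symm with ⟨q', h1, h2⟩ | ⟨q', h1, h2⟩ |
      ⟨b, s₁, s₂, c, h1, h2, h3, -⟩
    · exact .inl ⟨q', h1.symm, by simp [h2]⟩
    · exact .inr ⟨fun y => star (q'.plug y), fun x => lmul x q', by simp, by simp [h1], by simp [h2]⟩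
    -- A single bracket has breadth one, so it cannot straddle the boundary of a product.
    · have := congrArg breadth h3
      have h1 := mt breadth_eq_zero.1 h1
      have h2 := mt breadth_eq_zero.1 h2
      simp at this
      omega
  | cons z q ih =>
    cases q₂ with
    | star w => exact nomatch h
    | cons z' q₂ =>
      obtain ⟨rfl, h'⟩ := OpMon.cons.inj h
      rcases ih h' with ⟨q', h1, h2⟩ | ⟨r₁, r₂, h1, h2, h3⟩
      · exact .inl ⟨q', h1, by simp [h2]⟩
      · exact .inr ⟨fun y => cons z (r₁ y), fun x => cons z (r₂ x), by simp [h1], by simp [h2],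
          by simp [h3]⟩
    | brCons t q => exact nomatch h
    | inBr q w => exact nomatch h
  | brCons t q ih =>
    cases q₂ with
    | star w =>
      obtain ⟨rfl, rfl⟩ := OpMon.brCons.inj h
      exact .inr ⟨fun y => lmul y q, fun x => star (q.plug x), by simp, by simp, by simp⟩
    | cons z' q₂ => exact nomatch h
    | brCons t' q₂ =>
      obtain ⟨rfl, h'⟩ := OpMon.brCons.inj h
      rcases ih h' with ⟨q', h1, h2⟩ | ⟨r₁, r₂, h1, h2, h3⟩
      · exact .inl ⟨q', h1, by simp [h2]⟩
      · exact .inr ⟨fun y => brCons t (r₁ y), fun x => brCons t (r₂ x), by simp [h1], by simp [h2],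
          by simp [h3]⟩
    | inBr q₂ w =>
      obtain ⟨rfl, rfl⟩ := OpMon.brCons.inj h
      exact .inr ⟨fun y => brCons (q₂.plug y) q, fun x => inBr q₂ (q.plug x), by simp, by simp,
        by simp⟩
  | inBr q w ih =>
    cases q₂ with
    | star w' => exact absurd (eq_one_of_plug_eq_one (OpMon.brCons.inj h).1) hs
    | cons z' q₂ => exact nomatch h
    | brCons t' q₂ =>
      obtain ⟨rfl, rfl⟩ := OpMon.brCons.inj h
      exact .inr ⟨fun y => inBr q (q₂.plug y), fun x => brCons (q.plug x) q₂, by simp, by simp,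
        by simp⟩
    | inBr q₂ w' =>
      obtain ⟨h', rfl⟩ := OpMon.brCons.inj h
      rcases ih h' with ⟨q', h1, h2⟩ | ⟨r₁, r₂, h1, h2, h3⟩
      · exact .inl ⟨q', h1, by simp [h2]⟩
      · exact .inr ⟨fun y => inBr (r₁ y) w, fun x => inBr (r₂ x) w, by simp [h1], by simp [h2],
          by simp [h3]⟩

end StarWord

/-! ### Lexicographic and length-lexicographic comparison of lists. -/

namespace List

variable {α : Type*} {r r' : α → α → Prop}

/-- Equal lengths exclude the case of a proper prefix, so the lists differ at some first position.
-/
theorem Lex.exists_split {s t : List α} (h : Lex r s t) (hl : s.length = t.length) :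
    ∃ l a b s' t', s = l ++ a :: s' ∧ t = l ++ b :: t' ∧ r a b := by
  induction h with
  | nil => simp at hl
  | @cons a s t h ih =>
    obtain ⟨l, b, c, s', t', rfl, rfl, hr⟩ := ih (by simpa using hl)
    exact ⟨a :: l, b, c, s', t', rfl, rfl, hr⟩
  | @rel a s b t h => exact ⟨[], a, b, s, t, rfl, rfl, h⟩

theorem Lex.of_split {a b : α} (h : r a b) (l s t : List α) :
    Lex r (l ++ a :: s) (l ++ b :: t) :=
  Lex.append_left r (.rel h) l

theorem Lex.append_append {s t : List α} (h : Lex r s t) (hl : s.length = t.length)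
    (x y : List α) : Lex r (s ++ x) (t ++ y) := by
  obtain ⟨l, a, b, s, t, rfl, rfl, hr⟩ := h.exists_split hl
  simpa only [List.append_assoc, List.cons_append] using Lex.of_split hr l (s ++ x) (t ++ y)

/-- Only entries that occur in the two lists matter. This lets inductions on the $P$-degree restrict
the relation to contents of bounded degree. -/
theorem Lex.mono_mem {s t : List α} (h : Lex r s t)
    (H : ∀ a ∈ s, ∀ b ∈ t, r a b → r' a b) : Lex r' s t := by
  induction h with
  | nil => exact .nil
  | cons h ih =>
    exact .cons (ih fun a ha b hb => H a (mem_cons_of_mem _ ha) b (mem_cons_of_mem _ hb))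
  | rel h => exact .rel (H _ mem_cons_self _ mem_cons_self h)

theorem Shortlex.mono_mem {s t : List α} (h : Shortlex r s t)
    (H : ∀ a ∈ s, ∀ b ∈ t, r a b → r' a b) : Shortlex r' s t :=
  shortlex_def.2 ((shortlex_def.1 h).imp_right fun h => ⟨h.1, h.2.mono_mem H⟩)

theorem Shortlex.append_same {s t : List α} (h : Shortlex r s t) (x : List α) :
    Shortlex r (s ++ x) (t ++ x) := by
  rcases shortlex_def.1 h with h | ⟨h, h'⟩
  · exact .of_length_lt (by simpa using h)
  · exact .of_lex (by simpa using h) (h'.append_append h x x)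

theorem Shortlex.trichotomy_mem (s t : List α)
    (H : ∀ a ∈ s, ∀ b ∈ t, a = b ∨ r a b ∨ r b a) :
    s = t ∨ Shortlex r s t ∨ Shortlex r t s := by
  rcases lt_trichotomy s.length t.length with hl | hl | hl
  · exact .inr (.inl (.of_length_lt hl))
  · induction s generalizing t with
    | nil => exact .inl (length_eq_zero_iff.1 hl.symm).symm
    | cons a s ih =>
      cases t with
      | nil => simp at hl
      | cons b t =>
        simp only [length_cons, Nat.add_right_cancel_iff] at hl
        rcases H a mem_cons_self b mem_cons_self with rfl | h | h
        · rcases ih t (fun a ha b hb => H a (mem_cons_of_mem _ ha) b (mem_cons_of_mem _ hb)) hl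
            with rfl | h | h
          · exact .inl rfl
          · exact .inr (.inl (h.append_left [a]))
          · exact .inr (.inr (h.append_left [a]))
        · exact .inr (.inl (.of_lex (by simp [hl]) (.rel h)))
        · exact .inr (.inr (.of_lex (by simp [hl]) (.rel h)))
  · exact .inr (.inr (.of_length_lt hl))

end List

/-- A well-founded trichotomous relation compatible with all contexts yields a monomial order. -/
theorem isMonomialOrder_of_lt {Z : Type*} {le lt : OpMon Z → OpMon Z → Prop}
    (hle : ∀ u v, le u v ↔ u = v ∨ lt u v) (wf : WellFounded lt)
    (tri : ∀ u v, u = v ∨ lt u v ∨ lt v u)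
    (plug_lt : ∀ (q : StarWord Z) (u v : OpMon Z), lt u v → lt (q.plug u) (q.plug v)) :
    IsMonomialOrder le where
  refl u := (hle u u).2 (.inl rfl)
  trans u v w huv hvw := by
    rw [hle] at *
    rcases huv with rfl | huv
    · exact hvw
    rcases hvw with rfl | hvw
    · exact .inr huv
    rcases tri u w with h | h | h
    · exact .inl h
    · exact .inr h
    · exact (wf.asymmetric₃ _ _ _ huv hvw h).elim
  antisymm u v huv hvu := by
    rw [hle] at *
    rcases huv with rfl | huv
    · rfl
    rcases hvu with rfl | hvu
    · rfl
    exact absurd huv (wf.asymmetric _ _ hvu)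
  total u v := by
    simp only [hle]
    rcases tri u v with h | h | h
    exacts [.inl (.inl h), .inl (.inr h), .inr (.inr h)]
  wf := Subrelation.wf (fun {u v} h => ((hle u v).1 h.1).resolve_left h.2) wf
  plug_lt q u v h hne := by
    have h := plug_lt q u v (((hle u v).1 h).resolve_left hne)
    refine ⟨(hle _ _).2 (.inr h), fun he => ?_⟩
    rw [he] at h
    exact wf.irrefl.irrefl _ h

/-! ### The order $\le_{\rm db}$ is a monomial order. -/

namespace OpMon

variable {Z : Type*}

@[simp] theorem brackets_one : brackets (1 : OpMon Z) = [] := rfl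
@[simp] theorem brackets_cons (z : Z) (w : OpMon Z) : brackets (cons z w) = brackets w := rfl
@[simp] theorem brackets_brCons (u w : OpMon Z) : brackets (brCons u w) = u :: brackets w := rfl

@[simp] theorem brackets_mul (u v : OpMon Z) : brackets (u * v) = brackets u ++ brackets v := by
  induction u with
  | one => simp
  | cons z w ih => simp [ih]
  | brCons t w _ ih => simp [ih]

theorem degP_lt_of_mem_brackets {u t : OpMon Z} (h : t ∈ brackets u) : t.degP < u.degP := by
  induction u with
  | one => simp at h
  | cons z w ih => exact ih h
  | brCons s w _ ih =>
    rcases List.mem_cons.1 h with rfl | h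
    · simp; omega
    · have := ih h
      simp; omega

@[simp] theorem segments_one : segments (1 : OpMon Z) = [[]] := rfl
@[simp] theorem segments_cons (z : Z) (w : OpMon Z) :
    segments (cons z w) = (segments w).modifyHead (fun s => z :: s) := rfl
@[simp] theorem segments_brCons (u w : OpMon Z) : segments (brCons u w) = [] :: segments w := rfl

@[simp] theorem length_segments (u : OpMon Z) :
    (segments u).length = (brackets u).length + 1 := by
  induction u with
  | one => rfl
  | cons z w ih => simp [ih]
  | brCons t w _ ih => simp [ih]

theorem exists_segments_eq_cons (u : OpMon Z) : ∃ s l, segments u = s :: l :=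
  List.exists_cons_of_length_eq_add_one (length_segments u)

theorem eq_of_brackets_of_segments {u v : OpMon Z} (hb : brackets u = brackets v)
    (hs : segments u = segments v) : u = v := by
  induction u generalizing v with
  | one =>
    cases v with
    | one => rfl
    | cons z w =>
      obtain ⟨s, l, h⟩ := exists_segments_eq_cons w
      simp [h] at hs
    | brCons t w => simp at hb
  | cons z w ih =>
    obtain ⟨s, l, h⟩ := exists_segments_eq_cons w
    cases v with
    | one => simp [h] at hs
    | cons z' w' =>
      obtain ⟨s', l', h'⟩ := exists_segments_eq_cons w'
      simp only [segments_cons, h, h', List.modifyHead_cons, List.cons.injEq] at hs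
      rw [hs.1.1, ih (v := w') hb (by rw [h, h', hs.1.2, hs.2])]
    | brCons t w => simp [h] at hs
  | brCons t w _ ih =>
    cases v with
    | one => simp at hb
    | cons z' w' =>
      obtain ⟨s', l', h'⟩ := exists_segments_eq_cons w'
      simp [h'] at hs
    | brCons t' w' =>
      simp only [brackets_brCons, segments_brCons, List.cons.injEq, true_and] at hb hs
      rw [hb.1, ih hb.2 hs]

/-- `[u₀, …, u_r] ↦ [u₀, …, u_r v₀, v₁, …, v_s]`. -/
def glue : List (List Z) → List (List Z) → List (List Z)
  | [], m => m
  | [a], m => m.modifyHead (fun s => a ++ s)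
  | a :: b :: l, m => a :: glue (b :: l) m

theorem segments_mul (u v : OpMon Z) : segments (u * v) = glue (segments u) (segments v) := by
  induction u with
  | one =>
    obtain ⟨s, l, h⟩ := exists_segments_eq_cons v
    simp [glue, h]
  | cons z w ih =>
    obtain ⟨s, l, h⟩ := exists_segments_eq_cons v
    obtain ⟨s', l', h'⟩ := exists_segments_eq_cons w
    cases l' <;> simp [ih, h, h', glue]
  | brCons t w _ ih =>
    obtain ⟨s', l', h'⟩ := exists_segments_eq_cons w
    simp [ih, h', glue]

variable [LinearOrder Z]

/-- The lexicographical order on the lists `[u₀, …, u_r]`. -/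
abbrev SegLt : List (List Z) → List (List Z) → Prop :=
  List.Lex (List.Shortlex (fun a b : Z => a < b))

/-- Multiplying on the right changes the first `l.length` segments only in the last one, where a
common word is appended; this respects the degree lexicographical order. -/
theorem SegLt.glue {l l' m : List (List Z)} (h : SegLt l l') (hl : l.length = l'.length)
    (hm : m ≠ []) : SegLt (glue l m) (glue l' m) := by
  obtain ⟨b, m, rfl⟩ := List.exists_cons_of_ne_nil hm
  induction h with
  | nil => simp at hl
  | @cons a s t h ih =>
    have ih := ih (by simpa using hl)
    cases s <;> cases t
    · cases h
    · simp at hl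
    · simp at hl
    · exact .cons ih
  | @rel a s a' t h =>
    cases s <;> cases t
    · exact .rel (h.append_same b)
    · simp at hl
    · simp at hl
    · exact .rel h

/-- The comparison of $r$ followed by the lexicographic comparison of the $u_i^*$ is precisely
`List.Shortlex` on the lists of bracket contents. -/
theorem dbLt_iff {u v : OpMon Z} : DbLt u v ↔ u.degP < v.degP ∨ (u.degP = v.degP ∧
    (List.Shortlex DbLt u.brackets v.brackets ∨
      (u.brackets = v.brackets ∧ SegLt u.segments v.segments))) := by
  constructor
  · intro h
    cases h with
    | degP h => exact .inl h
    | breadthP h h' => exact .inr ⟨h, .inl (.of_length_lt h')⟩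
    | brackets h h' h1 h2 h3 =>
      exact .inr ⟨h, .inl (.of_lex h' (by rw [h1, h2]; exact List.Lex.of_split h3 _ _ _))⟩
    | segments h _ h2 h3 => exact .inr ⟨h, .inr ⟨h2, h3⟩⟩
  · rintro (h | ⟨h, h' | ⟨h1, h2⟩⟩)
    · exact .degP h
    · rcases List.shortlex_def.1 h' with h' | ⟨h1, h2⟩
      · exact .breadthP h h'
      · obtain ⟨l, a, b, s, t, h3, h4, h5⟩ := h2.exists_split h1
        exact .brackets h h1 h3 h4 h5
    · exact .segments h (congrArg List.length h1) h1 h2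

theorem dbLt_trichotomy (u v : OpMon Z) : u = v ∨ DbLt u v ∨ DbLt v u := by
  obtain ⟨n, hn⟩ := exists_gt u.degP
  induction n generalizing u v with
  | zero => omega
  | succ n ih =>
    rcases lt_trichotomy u.degP v.degP with h | h | h
    · exact .inr (.inl (.degP h))
    · rcases List.Shortlex.trichotomy_mem (r := DbLt) u.brackets v.brackets (fun a ha b _ =>
        ih a b (by have := degP_lt_of_mem_brackets ha; omega)) with hb | hb | hb
      -- Equal bracket lists force equally many segments, so `Lex` and `Shortlex` agree on the
      -- segment lists.
      · rcases List.Shortlex.trichotomy_mem (r := List.Shortlex (fun a b : Z => a < b))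
          u.segments v.segments (fun a _ b _ => List.Shortlex.trichotomy_mem a b
            fun x _ y _ => by rcases lt_trichotomy x y with h | h | h <;> simp [h])
          with hs | hs | hs
        · exact .inl (eq_of_brackets_of_segments hb hs)
        · exact .inr (.inl (dbLt_iff.2 (.inr ⟨h, .inr ⟨hb, (List.shortlex_iff_lex
            (by simp [hb])).1 hs⟩⟩)))
        · exact .inr (.inr (dbLt_iff.2 (.inr ⟨h.symm, .inr ⟨hb.symm, (List.shortlex_iff_lex
            (by simp [hb])).1 hs⟩⟩)))
      · exact .inr (.inl (dbLt_iff.2 (.inr ⟨h, .inl hb⟩)))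
      · exact .inr (.inr (dbLt_iff.2 (.inr ⟨h.symm, .inl hb⟩)))
    · exact .inr (.inr (.degP h))

/-- Induction on the bound: contents of brackets have $P$-degree below `n` when the word has
$P$-degree below `n + 1`. The segment lists are mapped into `Shortlex`, because plain `Lex` is not
well-founded on lists of unbounded length. -/
theorem dbLt_wf_of_degP_lt [WellFoundedLT Z] (n : ℕ) :
    WellFounded fun u v : OpMon Z => DbLt u v ∧ v.degP < n := by
  induction n with
  | zero => exact ⟨fun v => ⟨_, fun u h => absurd h.2 (Nat.not_lt_zero _)⟩⟩
  | succ n ih =>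
    have hw := (wellFounded_lt (α := ℕ)).prod_lex ((List.Shortlex.wf ih).prod_lex
      (List.Shortlex.wf (List.Shortlex.wf (wellFounded_lt (α := Z)))))
    refine Subrelation.wf ?_ (InvImage.wf
      (fun u : OpMon Z => (u.degP, u.brackets, u.segments)) hw)
    intro u v ⟨h, hv⟩
    rcases dbLt_iff.1 h with h | ⟨h, h' | ⟨h1, h2⟩⟩
    · exact Prod.Lex.left _ _ h
    · refine Prod.lex_def.2 (.inr ⟨h, Prod.Lex.left _ _ (h'.mono_mem fun a _ b hb hab => ⟨hab, ?_⟩)⟩)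
      have := degP_lt_of_mem_brackets hb
      omega
    · exact Prod.lex_def.2 (.inr ⟨h, Prod.lex_def.2 (.inr ⟨h1, .of_lex (by simp [h1]) h2⟩)⟩)

theorem _root_.DbLt.degP_le {u v : OpMon Z} (h : DbLt u v) : u.degP ≤ v.degP := by
  rcases dbLt_iff.1 h with h | h
  exacts [h.le, h.1.le]

/-- A descending chain never leaves the $P$-degree bound of its first term, so bounded
well-foundedness suffices. -/
theorem wf_of_forall_degP_lt {Y : Type*} {lt : OpMon Y → OpMon Y → Prop}
    (hle : ∀ u v, lt u v → u.degP ≤ v.degP)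
    (h : ∀ n, WellFounded fun u v : OpMon Y => lt u v ∧ v.degP < n) : WellFounded lt := by
  refine ⟨fun v => ?_⟩
  obtain ⟨n, hn⟩ := exists_gt v.degP
  induction (h n).apply v with
  | intro v _ ih =>
    exact ⟨_, fun u huv => ih u ⟨huv, hn⟩ ((hle _ _ huv).trans_lt hn)⟩

theorem _root_.DbLt.mul_right {u v : OpMon Z} (h : DbLt u v) (w : OpMon Z) : DbLt (u * w) (v * w) := by
  obtain ⟨s, l, hw⟩ := exists_segments_eq_cons w
  rcases dbLt_iff.1 h with h | ⟨h, h' | ⟨h1, h2⟩⟩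
  · exact .degP (by simpa using h)
  · exact dbLt_iff.2 (.inr ⟨by simpa using h, .inl (by simpa using h'.append_same _)⟩)
  · refine dbLt_iff.2 (.inr ⟨by simpa using h, .inr ⟨by simpa using h1, ?_⟩⟩)
    rw [segments_mul, segments_mul]
    exact h2.glue (by simp [h1]) (by simp [hw])

theorem _root_.DbLt.cons {u v : OpMon Z} (h : DbLt u v) (z : Z) : DbLt (cons z u) (cons z v) := by
  rcases dbLt_iff.1 h with h | ⟨h, h' | ⟨h1, h2⟩⟩
  · exact .degP (by simpa using h)
  · exact dbLt_iff.2 (.inr ⟨by simpa using h, .inl (by simpa using h')⟩)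
  · refine dbLt_iff.2 (.inr ⟨by simpa using h, .inr ⟨by simpa using h1, ?_⟩⟩)
    obtain ⟨s, l, hu⟩ := exists_segments_eq_cons u
    obtain ⟨s', l', hv⟩ := exists_segments_eq_cons v
    simp only [segments_cons, hu, hv, List.modifyHead_cons] at h2 ⊢
    cases h2 with
    | cons h => exact .cons h
    | rel h => exact .rel (h.append_left [z])

theorem _root_.DbLt.brCons {u v : OpMon Z} (h : DbLt u v) (t : OpMon Z) :
    DbLt (brCons t u) (brCons t v) := by
  rcases dbLt_iff.1 h with h | ⟨h, h' | ⟨h1, h2⟩⟩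
  · exact .degP (by simpa using h)
  · exact dbLt_iff.2 (.inr ⟨by simpa using h, .inl (by simpa using h'.append_left [t])⟩)
  · exact dbLt_iff.2 (.inr ⟨by simpa using h, .inr ⟨by simpa using h1, .cons h2⟩⟩)

/-- Either the $P$-degrees already differ, or they agree and the leftmost bracket content decides,
since the number of brackets at top level is unchanged. -/
theorem _root_.DbLt.inBr {u v : OpMon Z} (h : DbLt u v) (w : OpMon Z) :
    DbLt (OpMon.brCons u w) (OpMon.brCons v w) := by
  rcases h.degP_le.lt_or_eq with h' | h'
  · exact .degP (by simpa using h')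
  · exact dbLt_iff.2 (.inr ⟨by simpa using h', .inl (.of_lex (by simp) (.rel h))⟩)

theorem _root_.DbLt.plug {u v : OpMon Z} (h : DbLt u v) (q : StarWord Z) :
    DbLt (q.plug u) (q.plug v) := by
  induction q with
  | star w => exact h.mul_right w
  | cons z q ih => exact ih.cons z
  | brCons t q ih => exact ih.brCons t
  | inBr q w ih => exact ih.inBr w

theorem dbLe_isMonomialOrder [WellFoundedLT Z] : IsMonomialOrder (DbLe (Z := Z)) :=
  isMonomialOrder_of_lt (fun _ _ => Iff.rfl)
    (wf_of_forall_degP_lt (fun _ _ h => h.degP_le) dbLt_wf_of_degP_lt) dbLt_trichotomy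
    fun q _ _ h => h.plug q

end OpMon

/-! ### The order $\le_{\rm udl}$ is a monomial order. -/

namespace OpMon

section Degrees

variable {Z : Type*}

@[simp] theorem degX_one : degX (1 : OpMon Z) = 0 := rfl
@[simp] theorem degX_cons (z : Z) (w : OpMon Z) : degX (cons z w) = degX w + 1 := rfl
@[simp] theorem degX_brCons (u w : OpMon Z) : degX (brCons u w) = degX u + degX w := rfl
@[simp] theorem degX_br (u : OpMon Z) : degX (br u) = degX u := rfl
@[simp] theorem degX_var (z : Z) : degX (var z) = 1 := rfl
@[simp] theorem degP_var (z : Z) : degP (var z) = 0 := rfl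

@[simp] theorem degX_mul (u v : OpMon Z) : degX (u * v) = degX u + degX v := by
  induction u with
  | one => simp
  | cons z w ih => simp [ih]; omega
  | brCons t w _ ih => simp [ih]; omega

/-- Each bracket has two half brackets, and each of them gains `c` when `c` further letters stand to
the left. -/
theorem degGFrom_eq (c : ℕ) (u : OpMon Z) : degGFrom c u = 2 * c * degP u + degG u := by
  unfold degG
  induction u generalizing c with
  | one => rfl
  | cons z w ih =>
    simp only [degGFrom, degP_cons]
    rw [ih, ih (0 + 1)]
    ring
  | brCons t w iht ihw =>
    simp only [degGFrom, degP_brCons]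
    rw [iht c, ihw (c + degX t), ihw (0 + degX t)]
    ring

@[simp] theorem degG_one : degG (1 : OpMon Z) = 0 := rfl
@[simp] theorem degG_var (z : Z) : degG (var z) = 0 := rfl

@[simp] theorem degG_br (u : OpMon Z) : degG (br u) = degG u + degX u := by
  simp [degG, br, degGFrom]

@[simp] theorem degG_mul (u v : OpMon Z) :
    degG (u * v) = degG u + degG v + 2 * degX u * degP v := by
  induction u with
  | one => simp
  | cons z w ih =>
    simp only [cons_mul, degX_cons]
    simp only [degG, degGFrom]
    rw [degGFrom_eq, degGFrom_eq (0 + 1) w, ih]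
    simp only [degP_mul, degG]
    ring
  | brCons t w _ ih =>
    simp only [brCons_mul, degX_brCons]
    simp only [degG, degGFrom]
    rw [degGFrom_eq (0 + degX t), degGFrom_eq (0 + degX t) w, ih]
    simp only [degP_mul, degG]
    ring

theorem degP_lt_of_inr_mem_factors {u t : OpMon Z} (h : Sum.inr t ∈ factors u) :
    t.degP < u.degP := by
  induction u with
  | one => simp at h
  | cons z w ih => exact ih (by simpa using h)
  | brCons s w _ ih =>
    rcases List.mem_cons.1 h with h | h
    · obtain rfl := Sum.inr_injective h
      simp; omega
    · have := ih h
      simp; omega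

@[simp] theorem factors_var (z : Z) : factors (var z) = [Sum.inl z] := rfl
@[simp] theorem factors_br (u : OpMon Z) : factors (br u) = [Sum.inr u] := rfl

end Degrees

section Dlex

variable {Y : Type*} [LinearOrder Y]

theorem dlexLt_iff {u v : OpMon Y} :
    DlexLt u v ↔ List.Shortlex (Sum.Lex (· < ·) DlexLt) u.factors v.factors := by
  constructor
  · intro h
    cases h with
    | breadth h => exact .of_length_lt (by simpa [length_factors] using h)
    | letter h h1 h2 hab =>
      refine .of_lex (by simpa [length_factors] using h) ?_
      simpa [h1, h2] using List.Lex.of_split (Sum.Lex.inl hab) _ _ _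
    | letterBr h h1 h2 =>
      refine .of_lex (by simpa [length_factors] using h) ?_
      simpa [h1, h2] using List.Lex.of_split (Sum.Lex.sep _ _) _ _ _
    | br h h1 h2 hab =>
      refine .of_lex (by simpa [length_factors] using h) ?_
      simpa [h1, h2] using List.Lex.of_split (Sum.Lex.inr hab) _ _ _
  · intro h
    rcases List.shortlex_def.1 h with h | ⟨hl, h⟩
    · exact .breadth (by simpa [length_factors] using h)
    · obtain ⟨l, a, b, s, t, h1, h2, hab⟩ := h.exists_split hl
      simp only [length_factors] at hl
      obtain ⟨p, rfl⟩ := factors_surjective l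
      obtain ⟨s, rfl⟩ := factors_surjective s
      obtain ⟨t, rfl⟩ := factors_surjective t
      cases hab with
      | @inl a b hab =>
        exact .letter (p := p) (s := s) (t := t) hl (factors_injective (by simp [h1]))
          (factors_injective (by simp [h2])) hab
      | @inr a b hab =>
        exact .br (p := p) (s := s) (t := t) hl (factors_injective (by simp [h1]))
          (factors_injective (by simp [h2])) hab
      | sep a b =>
        exact .letterBr (p := p) (s := s) (t := t) (a := a) (b := b) hl (factors_injective (by simp [h1]))
          (factors_injective (by simp [h2]))

theorem dlexLt_trichotomy (u v : OpMon Y) : u = v ∨ DlexLt u v ∨ DlexLt v u := by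
  obtain ⟨n, hn⟩ := exists_gt u.degP
  induction n generalizing u v with
  | zero => omega
  | succ n ih =>
    have := List.Shortlex.trichotomy_mem (r := Sum.Lex (· < ·) DlexLt) u.factors v.factors
    rw [← dlexLt_iff, ← dlexLt_iff, factors_injective.eq_iff] at this
    refine this fun a ha b _ => ?_
    rcases a with a | a <;> rcases b with b | b
    · rcases lt_trichotomy a b with h | h | h <;> simp [h]
    · simp
    · simp
    · have := degP_lt_of_inr_mem_factors ha
      simpa using ih a b (by omega)

/-- Both $P$-degrees are bounded because `DlexLt` alone does not control them: a word of smaller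
breadth may contain more brackets. -/
theorem dlexLt_wf_of_degP_lt [WellFoundedLT Y] (n : ℕ) :
    WellFounded fun u v : OpMon Y => DlexLt u v ∧ u.degP < n ∧ v.degP < n := by
  induction n with
  | zero => exact ⟨fun v => ⟨_, fun u h => absurd h.2.1 (Nat.not_lt_zero _)⟩⟩
  | succ n ih =>
    refine Subrelation.wf ?_ (InvImage.wf factors
      (List.Shortlex.wf (Sum.lex_wf (wellFounded_lt (α := Y)) ih)))
    intro u v ⟨h, hu, hv⟩
    refine (dlexLt_iff.1 h).mono_mem fun a ha b hb hab => ?_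
    cases hab with
    | inl h => exact .inl h
    | sep a b => exact .sep a b
    | inr h =>
      have := degP_lt_of_inr_mem_factors ha
      have := degP_lt_of_inr_mem_factors hb
      exact .inr ⟨h, by omega, by omega⟩

theorem _root_.DlLt.degP_le {u v : OpMon Y} (h : DlLt u v) : u.degP ≤ v.degP := by
  rcases h with h | h
  exacts [h.le, h.1.le]

theorem dlLt_trichotomy (u v : OpMon Y) : u = v ∨ DlLt u v ∨ DlLt v u := by
  unfold DlLt
  rcases lt_trichotomy u.degP v.degP with h | h | h
  · simp [h]
  · rcases lt_trichotomy u.degX v.degX with h' | h' | h'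
    · simp [h, h']
    · rcases lt_trichotomy u.degG v.degG with h'' | h'' | h''
      · simp [h, h', h'']
      · simpa [h, h', h''] using dlexLt_trichotomy u v
      · simp [h, h', h'']
    · simp [h, h']
  · simp [h]

theorem dlLt_wf [WellFoundedLT Y] : WellFounded (DlLt (Y := Y)) := by
  refine wf_of_forall_degP_lt (fun _ _ h => h.degP_le) fun n => ?_
  have hN := wellFounded_lt (α := ℕ)
  refine Subrelation.wf ?_ (InvImage.wf (fun u : OpMon Y => (u.degP, u.degX, u.degG, u))
    (hN.prod_lex (hN.prod_lex (hN.prod_lex (dlexLt_wf_of_degP_lt n)))))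
  intro u v ⟨h, hv⟩
  rcases h with h | ⟨h1, h | ⟨h2, h | ⟨h3, h⟩⟩⟩
  · exact Prod.Lex.left _ _ h
  · exact Prod.lex_def.2 (.inr ⟨h1, Prod.Lex.left _ _ h⟩)
  · exact Prod.lex_def.2 (.inr ⟨h1, Prod.lex_def.2 (.inr ⟨h2, Prod.Lex.left _ _ h⟩)⟩)
  · exact Prod.lex_def.2 (.inr ⟨h1, Prod.lex_def.2 (.inr ⟨h2, Prod.lex_def.2 (.inr ⟨h3, h,
      h1.trans_lt hv, hv⟩)⟩)⟩)

theorem _root_.DlLt.mul_left {u v : OpMon Y} (h : DlLt u v) (p : OpMon Y) :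
    DlLt (p * u) (p * v) := by
  rcases h with h | ⟨h1, h | ⟨h2, h | ⟨h3, h⟩⟩⟩
  · exact .inl (by simpa using h)
  · exact .inr ⟨by simpa using h1, .inl (by simpa using h)⟩
  · exact .inr ⟨by simpa using h1, .inr ⟨by simpa using h2, .inl (by simpa [h1] using h)⟩⟩
  · refine .inr ⟨by simpa using h1, .inr ⟨by simpa using h2, .inr ⟨by simp [h1, h3], ?_⟩⟩⟩
    rw [dlexLt_iff] at h ⊢
    simpa using h.append_left _

theorem _root_.DlLt.mul_right {u v : OpMon Y} (h : DlLt u v) (p : OpMon Y) :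
    DlLt (u * p) (v * p) := by
  rcases h with h | ⟨h1, h | ⟨h2, h | ⟨h3, h⟩⟩⟩
  · exact .inl (by simpa using h)
  · exact .inr ⟨by simpa using h1, .inl (by simpa using h)⟩
  · exact .inr ⟨by simpa using h1, .inr ⟨by simpa using h2, .inl (by simpa [h2] using h)⟩⟩
  · refine .inr ⟨by simpa using h1, .inr ⟨by simpa using h2, .inr ⟨by simp [h2, h3], ?_⟩⟩⟩
    rw [dlexLt_iff] at h ⊢
    simpa using h.append_same _

theorem _root_.DlLt.br {u v : OpMon Y} (h : DlLt u v) : DlLt (br u) (br v) := by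
  rcases h with h | ⟨h1, h | ⟨h2, h | ⟨h3, h⟩⟩⟩
  · exact .inl (by simpa using h)
  · exact .inr ⟨by simpa using h1, .inl (by simpa using h)⟩
  · exact .inr ⟨by simpa using h1, .inr ⟨by simpa using h2, .inl (by simpa [h2] using h)⟩⟩
  · refine .inr ⟨by simpa using h1, .inr ⟨by simpa using h2, .inr ⟨by simp [h2, h3], ?_⟩⟩⟩
    rw [dlexLt_iff]
    exact .of_lex rfl (.rel (.inr h))

theorem one_dlLt {u : OpMon Y} (h : u ≠ 1) : DlLt 1 u := by
  rcases dlLt_trichotomy 1 u with h' | h' | h'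
  · exact absurd h'.symm h
  · exact h'
  · rcases h' with h' | ⟨-, h' | ⟨-, h' | ⟨-, h'⟩⟩⟩
    · simp at h'
    · simp at h'
    · simp at h'
    · rw [dlexLt_iff] at h'
      simp at h'

end Dlex

section Dagger

variable {Z : Type*}

@[simp] theorem dagger_one : dagger (1 : OpMon Z) = 1 := rfl
@[simp] theorem dagger_cons (z : Z) (w : OpMon Z) :
    dagger (cons z w) = cons (z : WithBot Z) (dagger w) := rfl
@[simp] theorem dagger_br_one : dagger (br 1 : OpMon Z) = var ⊥ := rfl
theorem dagger_brCons_one (w : OpMon Z) : dagger (brCons 1 w) = cons ⊥ (dagger w) := rfl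

theorem dagger_brCons {t : OpMon Z} (ht : t ≠ 1) (w : OpMon Z) :
    dagger (brCons t w) = brCons (dagger t) (dagger w) := by
  cases t with
  | one => exact absurd rfl ht
  | cons z u => rfl
  | brCons s u => rfl

@[simp] theorem dagger_br {t : OpMon Z} (ht : t ≠ 1) : dagger (br t) = br (dagger t) :=
  dagger_brCons ht 1

@[simp] theorem dagger_mul (u v : OpMon Z) : dagger (u * v) = dagger u * dagger v := by
  induction u with
  | one => simp
  | cons z w ih => simp [ih]
  | brCons t w _ ih =>
    by_cases ht : t = 1
    · subst ht
      simp [dagger_brCons_one, ih]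
    · simp [dagger_brCons ht, ih]

@[simp] theorem dagger_eq_one {u : OpMon Z} : dagger u = 1 ↔ u = 1 := by
  cases u with
  | one => simp
  | cons z w => simp
  | brCons t w =>
    by_cases ht : t = 1
    · subst ht
      simp [dagger_brCons_one]
    · simp [dagger_brCons ht]

theorem dagger_injective : Function.Injective (dagger (Z := Z)) := by
  intro u
  induction u with
  | one => intro v h; exact (dagger_eq_one.1 h.symm).symm
  | cons z w ih =>
    intro v h
    cases v with
    | one => simp at h
    | cons z' w' =>
      simp only [dagger_cons, cons.injEq, WithBot.coe_inj] at h
      rw [h.1, ih h.2]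
    | brCons t w' =>
      by_cases ht : t = 1
      · subst ht
        simp [dagger_brCons_one] at h
      · simp [dagger_brCons ht] at h
  | brCons t w iht ihw =>
    intro v h
    cases v with
    | one => simp at h
    | cons z' w' =>
      by_cases ht : t = 1
      · subst ht
        simp [dagger_brCons_one] at h
      · simp [dagger_brCons ht] at h
    | brCons t' w' =>
      by_cases ht : t = 1 <;> by_cases ht' : t' = 1
      · subst ht ht'
        simp only [dagger_brCons_one, cons.injEq, true_and] at h
        rw [ihw h]
      · subst ht
        simp [dagger_brCons_one, dagger_brCons ht'] at h
      · subst ht'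
        simp [dagger_brCons_one, dagger_brCons ht] at h
      · simp only [dagger_brCons ht, dagger_brCons ht', brCons.injEq] at h
        rw [iht h.1, ihw h.2]

theorem degX_dagger_pos {u : OpMon Z} (h : u ≠ 1) : 0 < degX (dagger u) := by
  induction u with
  | one => exact absurd rfl h
  | cons z w => simp
  | brCons t w iht _ =>
    by_cases ht : t = 1
    · subst ht
      simp [dagger_brCons_one]
    · have := iht ht
      simp [dagger_brCons ht]
      omega

variable [LinearOrder Z]

theorem dagger_plug_dlLt (q : StarWord Z) {u v : OpMon Z} (h : DlLt u.dagger v.dagger) :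
    DlLt (q.plug u).dagger (q.plug v).dagger := by
  induction q with
  | star w => simpa using h.mul_right _
  | cons z q ih => exact ih.mul_left (var (z : WithBot Z))
  | brCons t q ih => simpa [← br_mul] using ih.mul_left (dagger (br t))
  | inBr q w ih =>
    suffices H : DlLt (br (q.plug u)).dagger (br (q.plug v)).dagger by
      simpa [← br_mul] using H.mul_right (dagger w)
    -- Nothing is smaller than the empty word, so the larger content is nonempty and keeps its
    -- bracket.
    have hv : q.plug v ≠ 1 := by
      intro hv
      rw [hv] at ih
      rcases ih with h' | ⟨-, h' | ⟨-, h' | ⟨-, h'⟩⟩⟩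
      · simp at h'
      · simp at h'
      · simp at h'
      · rw [dlexLt_iff] at h'
        simp at h'
    -- If the smaller content is empty, its bracket turns into the letter `⊥` and has $P$-degree
    -- `0`, whereas the other side has positive $P$-degree.
    by_cases hu : q.plug u = 1
    · rw [hu, dagger_br hv]
      exact .inl (by simp)
    · rw [dagger_br hu, dagger_br hv]
      exact ih.br

variable [WellFoundedLT Z]

/-- The empty word is already least for `DlLt`, so the separate clause for `1` in `UdlLe` is
absorbed. -/
theorem udlLe_iff {u v : OpMon Z} : UdlLe u v ↔ u = v ∨ DlLt u.dagger v.dagger := by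
  have hir (w : OpMon (WithBot Z)) : ¬ DlLt w w := dlLt_wf.irrefl.irrefl w
  unfold UdlLe
  refine or_congr Iff.rfl ⟨?_, fun h => ?_⟩
  · rintro (⟨rfl, hv⟩ | ⟨-, -, h⟩)
    · exact one_dlLt (by simpa using hv)
    · exact h
  · by_cases hu : u = 1
    · subst hu
      exact .inl ⟨rfl, fun hv => hir _ (by simpa [hv] using h)⟩
    · refine .inr ⟨hu, fun hv => ?_, h⟩
      subst hv
      exact dlLt_wf.asymmetric _ _ h (one_dlLt (by simpa using hu))

theorem udlLe_isMonomialOrder : IsMonomialOrder (UdlLe (Z := Z)) :=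
  isMonomialOrder_of_lt (lt := InvImage DlLt dagger) (fun _ _ => udlLe_iff)
    (InvImage.wf _ dlLt_wf)
    (fun u v => by rw [← dagger_injective.eq_iff]; exact dlLt_trichotomy _ _)
    fun q _ _ h => dagger_plug_dlLt q h

end Dagger

end OpMon

theorem chooseOr_pos {α : Type*} {p : α → Prop} {d : α} (h : ∃ a, p a) : p (chooseOr p d) := by
  simp only [chooseOr, dif_pos h]
  exact h.choose_spec

theorem chooseOr_neg {α : Type*} {p : α → Prop} {d : α} (h : ¬ ∃ a, p a) : chooseOr p d = d := by
  simp only [chooseOr, dif_neg h]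

/-! ### Contexts and the operator as linear maps. -/

section Polynomials

variable {k : Type*} [Field k] {Z : Type*}

theorem mon_mul (u v : OpMon Z) : mon k (u * v) = mon k u * mon k v := by
  simp [mon]

theorem mon_one : mon k (1 : OpMon Z) = 1 := rfl

theorem OpPoly.induction_mon {motive : OpPoly k Z → Prop} (p : OpPoly k Z)
    (zero : motive 0) (add : ∀ x y, motive x → motive y → motive (x + y))
    (smul_mon : ∀ (c : k) m, motive (c • mon k m)) : motive p :=
  MonoidAlgebra.induction_linear p zero add fun m c => by simpa [mon] using smul_mon c m

/-- The map `s ↦ q|_s` as a linear map. -/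
def StarWord.plugLin (k : Type*) [Field k] {Z : Type*} (q : StarWord Z) :
    OpPoly k Z →ₗ[k] OpPoly k Z :=
  MonoidAlgebra.mapDomainLinearMap k k q.plug

@[simp] theorem StarWord.plugLin_mon (q : StarWord Z) (u : OpMon Z) :
    q.plugLin k (mon k u) = mon k (q.plug u) := by
  simp [plugLin, mon]

/-- The operator `⌊·⌋` on `𝐤𝔐(Z)`. -/
def opBr : OpPoly k Z →ₗ[k] OpPoly k Z := MonoidAlgebra.mapDomainLinearMap k k br

@[simp] theorem opBr_mon (u : OpMon Z) : opBr (mon k u) = mon k (br u) := by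
  simp [opBr, mon]

/-- Linear maps that agree on monomials are equal. -/
theorem OpPoly.linearMap_ext {M : Type*} [AddCommGroup M] [Module k M]
    {f g : OpPoly k Z →ₗ[k] M} (h : ∀ m, f (mon k m) = g (mon k m)) (p : OpPoly k Z) :
    f p = g p := by
  induction p using OpPoly.induction_mon with
  | zero => simp
  | add x y hx hy => simp [hx, hy]
  | smul_mon c m => simp [h]

theorem StarWord.plugLin_congr {q r : StarWord Z} (h : ∀ x, q.plug x = r.plug x)
    (p : OpPoly k Z) : q.plugLin k p = r.plugLin k p :=
  OpPoly.linearMap_ext (fun m => by simp [h]) p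

theorem StarWord.plugLin_eq_self {q : StarWord Z} (h : ∀ x, q.plug x = x) (p : OpPoly k Z) :
    q.plugLin k p = p :=
  OpPoly.linearMap_ext (g := LinearMap.id) (fun m => by simp [h]) p

theorem StarWord.plugLin_eq_comp {q r r' : StarWord Z} (h : ∀ x, q.plug x = r.plug (r'.plug x))
    (p : OpPoly k Z) : q.plugLin k p = r.plugLin k (r'.plugLin k p) :=
  OpPoly.linearMap_ext (g := r.plugLin k ∘ₗ r'.plugLin k) (fun m => by simp [h]) p

theorem StarWord.plugLin_eq_mul {q r : StarWord Z} {a b : OpMon Z}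
    (h : ∀ x, q.plug x = a * r.plug x * b) (p : OpPoly k Z) :
    q.plugLin k p = mon k a * r.plugLin k p * mon k b :=
  OpPoly.linearMap_ext (g := LinearMap.mulRight k (mon k b) ∘ₗ LinearMap.mulLeft k (mon k a) ∘ₗ
    r.plugLin k) (fun m => by simp [h, mon_mul]) p

theorem StarWord.plugLin_eq_mul_id {q : StarWord Z} {a b : OpMon Z}
    (h : ∀ x, q.plug x = a * x * b) (p : OpPoly k Z) :
    q.plugLin k p = mon k a * p * mon k b := by
  rw [plugLin_eq_mul (r := .star 1) (by simpa using h), plugLin_eq_self (by simp)]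

theorem StarWord.plugLin_eq_opBr {q r : StarWord Z} (h : ∀ x, q.plug x = br (r.plug x))
    (p : OpPoly k Z) : q.plugLin k p = opBr (r.plugLin k p) :=
  OpPoly.linearMap_ext (g := opBr ∘ₗ r.plugLin k) (fun m => by simp [h]) p

end Polynomials

/-! ### Leading monomials, filtered ideals and a criterion for GS bases. -/

section Ideals

variable {k : Type*} [Field k] {Z : Type*} {le : OpMon Z → OpMon Z → Prop}

namespace IsMonomialOrder

theorem lt_of_le_of_lt (hle : IsMonomialOrder le) {u v w : OpMon Z} (h : le u v)
    (h' : le v w ∧ v ≠ w) : le u w ∧ u ≠ w :=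
  ⟨hle.trans _ _ _ h h'.1, fun he => h'.2 (hle.antisymm _ _ h'.1 (he ▸ h))⟩

theorem plug_le (hle : IsMonomialOrder le) (q : StarWord Z) {u v : OpMon Z} (h : le u v) :
    le (q.plug u) (q.plug v) := by
  by_cases he : u = v
  · rw [he]
    exact hle.refl _
  · exact (hle.plug_lt q u v h he).1

theorem mul_right_lt (hle : IsMonomialOrder le) {u v : OpMon Z} (h : le u v ∧ u ≠ v)
    (w : OpMon Z) : le (u * w) (v * w) ∧ u * w ≠ v * w :=
  hle.plug_lt (.star w) u v h.1 h.2

theorem mul_left_lt (hle : IsMonomialOrder le) {u v : OpMon Z} (h : le u v ∧ u ≠ v)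
    (w : OpMon Z) : le (w * u) (w * v) ∧ w * u ≠ w * v := by
  simpa using hle.plug_lt (.lmul w (.star 1)) u v h.1 h.2

/-- If some element were below `1`, a least such `m` would satisfy `m * m < m < 1`, a contradiction.
-/
theorem one_le (hle : IsMonomialOrder le) (u : OpMon Z) : le 1 u := by
  by_contra h
  have hu : le u 1 ∧ u ≠ 1 :=
    ⟨(hle.total u 1).resolve_right h, fun he => h (he ▸ hle.refl _)⟩
  obtain ⟨m, hm, hmin⟩ := hle.wf.has_min {v | le v 1 ∧ v ≠ 1} ⟨u, hu⟩
  have h1 := hle.mul_right_lt hm m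
  rw [one_mul] at h1
  exact hmin _ (hle.lt_of_le_of_lt h1.1 hm) h1

end IsMonomialOrder

/-- The polynomials all of whose monomials are smaller than `w`. -/
def below (k : Type*) [Field k] {Z : Type*} (le : OpMon Z → OpMon Z → Prop) (w : OpMon Z) :
    Submodule k (OpPoly k Z) :=
  MonoidAlgebra.supported k k {m | le m w ∧ m ≠ w}

theorem mon_mem_below {u w : OpMon Z} (h : le u w ∧ u ≠ w) : mon k u ∈ below k le w := by
  rw [below, MonoidAlgebra.supported_eq_span_single]
  exact Submodule.subset_span ⟨u, h, rfl⟩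

theorem below_le {w : OpMon Z} {S : Submodule k (OpPoly k Z)}
    (h : ∀ u, le u w ∧ u ≠ w → mon k u ∈ S) : below k le w ≤ S := by
  rw [below, MonoidAlgebra.supported_eq_span_single, Submodule.span_le]
  rintro _ ⟨u, hu, rfl⟩
  exact h u hu

theorem coeff_eq_zero_of_mem_below {p : OpPoly k Z} {u w : OpMon Z} (h : p ∈ below k le w)
    (hu : ¬ (le u w ∧ u ≠ w)) : p.coeff u = 0 :=
  MonoidAlgebra.mem_supported'.1 h u hu

theorem coeff_eq_one {p : OpPoly k Z} {w : OpMon Z} (h : p - mon k w ∈ below k le w) :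
    p.coeff w = 1 := by
  have := coeff_eq_zero_of_mem_below h (u := w) (by simp)
  simpa [mon, sub_eq_zero] using this

theorem le_of_mem_support (hle : IsMonomialOrder le) {p : OpPoly k Z} {u w : OpMon Z}
    (h : p - mon k w ∈ below k le w) (hu : u ∈ p.coeff.support) : le u w := by
  by_contra hn
  have := coeff_eq_zero_of_mem_below h (u := u) (fun h => hn h.1)
  have hne : w ≠ u := fun he => hn (he ▸ hle.refl _)
  simp [mon, hne] at this
  simp [this] at hu

theorem leadMon_eq (hle : IsMonomialOrder le) {p : OpPoly k Z} {w : OpMon Z}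
    (h : p - mon k w ∈ below k le w) : leadMon le p = w := by
  have hw : w ∈ p.coeff.support := by simp [coeff_eq_one h]
  have := chooseOr_pos (d := (1 : OpMon Z)) (p := fun m => m ∈ p.coeff.support ∧
    ∀ n ∈ p.coeff.support, le n m) ⟨w, hw, fun n hn => le_of_mem_support hle h hn⟩
  exact hle.antisymm _ _ (le_of_mem_support hle h this.1) (this.2 w hw)

theorem leadMon_le (hle : IsMonomialOrder le) {p : OpPoly k Z} {w : OpMon Z}
    (h : ∀ u ∈ p.coeff.support, le u w) : le (leadMon le p) w := by
  by_cases he : ∃ m, m ∈ p.coeff.support ∧ ∀ n ∈ p.coeff.support, le n m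
  · exact h _ (chooseOr_pos (d := (1 : OpMon Z)) he).1
  -- Here the leading monomial takes its default value `1`, as for the zero polynomial; `1` is
  -- least.
  · rw [leadMon, chooseOr_neg he]
    exact hle.one_le w

theorem monicize_eq (hle : IsMonomialOrder le) {p : OpPoly k Z} {w : OpMon Z}
    (h : p - mon k w ∈ below k le w) : monicize le p = p := by
  rw [monicize, leadMon_eq hle h, coeff_eq_one h, inv_one, one_smul]

variable {G : Set (OpPoly k Z)}

/-- The linear combinations of elements `q|_s` with `s ∈ G` and `q|_s̄ ≤ w`. -/
def idealLE (le : OpMon Z → OpMon Z → Prop) (G : Set (OpPoly k Z)) (w : OpMon Z) :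
    Submodule k (OpPoly k Z) :=
  Submodule.span k {h | ∃ (q : StarWord Z) (s : OpPoly k Z), s ∈ G ∧
    le (q.plug (leadMon le s)) w ∧ h = q.plugLin k s}

/-- The elements that are trivial modulo `(G, w)`. -/
def idealLT (le : OpMon Z → OpMon Z → Prop) (G : Set (OpPoly k Z)) (w : OpMon Z) :
    Submodule k (OpPoly k Z) :=
  Submodule.span k {h | ∃ (q : StarWord Z) (s : OpPoly k Z), s ∈ G ∧
    le (q.plug (leadMon le s)) w ∧ q.plug (leadMon le s) ≠ w ∧ h = q.plugPoly s}

theorem idealLE_mono (hle : IsMonomialOrder le) {u w : OpMon Z} (h : le u w) :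
    idealLE le G u ≤ idealLE le G w := by
  refine Submodule.span_mono ?_
  rintro _ ⟨q, s, hs, hq, rfl⟩
  exact ⟨q, s, hs, hle.trans _ _ _ hq h, rfl⟩

theorem idealLE_le_idealLT (hle : IsMonomialOrder le) {u w : OpMon Z} (h : le u w ∧ u ≠ w) :
    idealLE le G u ≤ idealLT le G w := by
  refine Submodule.span_mono ?_
  rintro _ ⟨q, s, hs, hq, rfl⟩
  have := hle.lt_of_le_of_lt hq h
  exact ⟨q, s, hs, this.1, this.2, rfl⟩

theorem plugLin_mem_idealLE (hle : IsMonomialOrder le) (q : StarWord Z) {p : OpPoly k Z}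
    {w : OpMon Z} (h : p ∈ idealLE le G w) : q.plugLin k p ∈ idealLE le G (q.plug w) := by
  suffices idealLE le G w ≤ (idealLE le G (q.plug w)).comap (q.plugLin k) from this h
  refine Submodule.span_le.2 ?_
  rintro _ ⟨r, s, hs, hr, rfl⟩
  refine Submodule.subset_span ⟨q.comp r, s, hs, ?_, ?_⟩
  · simpa using hle.plug_le q hr
  · exact (StarWord.plugLin_eq_comp (by simp) _).symm

theorem plugLin_mem_idealLT (hle : IsMonomialOrder le) (q : StarWord Z) {p : OpPoly k Z}
    {w : OpMon Z} (h : p ∈ idealLT le G w) : q.plugLin k p ∈ idealLT le G (q.plug w) := by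
  suffices idealLT le G w ≤ (idealLT le G (q.plug w)).comap (q.plugLin k) from this h
  refine Submodule.span_le.2 ?_
  rintro _ ⟨r, s, hs, hr, hr', rfl⟩
  refine Submodule.subset_span ⟨q.comp r, s, hs, ?_, ?_, ?_⟩
  · simpa using hle.plug_le q hr
  · simpa using (hle.plug_lt q _ _ hr hr').2
  · exact (StarWord.plugLin_eq_comp (by simp) _).symm

theorem mul_mem_idealLE (hle : IsMonomialOrder le) {p : OpPoly k Z} {w : OpMon Z}
    (h : p ∈ idealLE le G w) (b : OpMon Z) : p * mon k b ∈ idealLE le G (w * b) := by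
  have := plugLin_mem_idealLE hle (.star b) h
  rwa [StarWord.plugLin_eq_mul_id (a := 1) (b := b) (by simp), mon_one, one_mul] at this

theorem mon_mul_mem_idealLE (hle : IsMonomialOrder le) {p : OpPoly k Z} {w : OpMon Z}
    (h : p ∈ idealLE le G w) (a : OpMon Z) : mon k a * p ∈ idealLE le G (a * w) := by
  have := plugLin_mem_idealLE hle (.lmul a (.star 1)) h
  rwa [StarWord.plugLin_eq_mul_id (a := a) (b := 1) (by simp), mon_one, mul_one,
    StarWord.plug_lmul, StarWord.plug_star, mul_one] at this

theorem opBr_mem_idealLE (hle : IsMonomialOrder le) {p : OpPoly k Z} {w : OpMon Z}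
    (h : p ∈ idealLE le G w) : opBr p ∈ idealLE le G (br w) := by
  have := plugLin_mem_idealLE hle (.inBr (.star 1) 1) h
  rwa [StarWord.plugLin_eq_opBr (r := .star 1) (by simp [br]),
    StarWord.plugLin_eq_self (by simp), StarWord.plug_inBr, StarWord.plug_star, mul_one] at this

/-- Elements of `G` with all monomials at most `w`. -/
theorem mem_idealLE (hle : IsMonomialOrder le) {s : OpPoly k Z} {w : OpMon Z} (hs : s ∈ G)
    (h : ∀ u ∈ s.coeff.support, le u w) : s ∈ idealLE le G w :=
  Submodule.subset_span ⟨.star 1, s, hs, by simpa using leadMon_le hle h,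
    (StarWord.plugLin_eq_self (by simp) _).symm⟩

theorem mem_idealLE_of_sub_mem (hle : IsMonomialOrder le) {s : OpPoly k Z} {w : OpMon Z}
    (hs : s ∈ G) (h : s - mon k w ∈ below k le w) : s ∈ idealLE le G w :=
  mem_idealLE hle hs fun _ hu => le_of_mem_support hle h hu

/-- A family of elements `Φ(m)`, linear in `m`, with leading part `q₀|_m`: the inclusion
composition with an element of `G` whose leading monomial occurs in `m` is trivial. -/
theorem sub_plugLin_mem_idealLT (hle : IsMonomialOrder le) {Φ : OpPoly k Z →ₗ[k] OpPoly k Z}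
    (q₀ q : StarWord Z) {g : OpPoly k Z} {l : OpMon Z}
    (hl : g - mon k l ∈ below k le l)
    (hΦ : ∀ m, Φ (mon k m) ∈ idealLE le G (q₀.plug m))
    (hR : Φ (q.plugLin k g) - q₀.plugLin k (q.plugLin k g) ∈
      idealLT le G (q₀.plug (q.plug l))) :
    Φ (mon k (q.plug l)) - q₀.plugLin k (q.plugLin k g) ∈ idealLT le G (q₀.plug (q.plug l)) := by
  -- Write $\bar g=g-(g-\bar g)$. Applied to $q|_{g-\bar g}$, the map `Φ` yields instances with
  -- leading monomials $q_0|_{q|_u}$, $u<\bar g$. Applied to $q|_g$ it is covered by `hR`.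
  have h : below k le l ≤ (idealLT le G (q₀.plug (q.plug l))).comap (Φ ∘ₗ q.plugLin k) := by
    refine below_le fun u hu => ?_
    have h1 := hle.plug_lt q _ _ hu.1 hu.2
    simpa using idealLE_le_idealLT hle (hle.plug_lt q₀ _ _ h1.1 h1.2) (hΦ (q.plug u))
  have h2 := h hl
  simp only [Submodule.mem_comap, LinearMap.comp_apply, map_sub, StarWord.plugLin_mon] at h2
  convert sub_mem hR h2 using 1
  abel

/-- A criterion for Gröbner–Shirshov bases that are families of monic polynomials. -/
theorem isOperatedGSBasis_range (hle : IsMonomialOrder le) {ι : Type*} {F : ι → OpPoly k Z}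
    {L : ι → OpMon Z} {good : ι → Prop} (hzero : ∀ i, ¬ good i → F i = 0)
    (hlead : ∀ i, good i → F i - mon k (L i) ∈ below k le (L i))
    (hint : ∀ i j, good i → good j → ∀ u v, L i * u = v * L j → u ≠ 1 → v ≠ 1 →
      u.breadth < (L j).breadth →
      F i * mon k u - mon k v * F j ∈ idealLT le (Set.range F) (L i * u))
    (hinc : ∀ i j, good i → good j → ∀ q : StarWord Z, q.plug (L j) = L i →
      F i - q.plugLin k (F j) ∈ idealLT le (Set.range F) (L i)) :
    IsOperatedGSBasis le (Set.range F) := by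
  rintro _ ⟨i, rfl⟩ _ ⟨j, rfl⟩ hi hj
  replace hi : good i := by_contra fun h => hi (hzero i h)
  replace hj : good j := by_contra fun h => hj (hzero j h)
  rw [monicize_eq hle (hlead i hi), monicize_eq hle (hlead j hj)]
  refine ⟨fun w u v hu hv h1 h2 => ?_, fun w q hw hq => ?_⟩
  · rw [leadMon_eq hle (hlead i hi)] at hu h1 h2
    rw [leadMon_eq hle (hlead j hj)] at hv h1 h2
    subst hu
    have hb := congrArg breadth hv
    simp only [breadth_mul, max_lt_iff] at hb h1 h2
    refine hint i j hi hj u v hv (fun h => ?_) (fun h => ?_) (by omega)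
    · simp [h] at h1
    · rw [h, breadth_one] at hb
      omega
  · rw [leadMon_eq hle (hlead i hi)] at hw
    rw [leadMon_eq hle (hlead j hj)] at hq
    subst hw
    exact hinc i j hi hj q hq.symm

end Ideals

/-! ### Substitution instances of one identity. -/

section Substitution

variable {k : Type*} [Field k] {X Z : Type*}

namespace OpMon

@[simp] theorem subst_mul (f : X → OpMon Z) (u v : OpMon X) :
    subst f (u * v) = subst f u * subst f v := by
  induction u with
  | one => rfl
  | cons z w ih => simp only [cons_mul, subst, ih, mul_assoc]
  | brCons t w _ ih => simp only [brCons_mul, subst, ih, mul_assoc]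

@[simp] theorem subst_one (f : X → OpMon Z) : subst f 1 = 1 := rfl
@[simp] theorem subst_br (f : X → OpMon Z) (u : OpMon X) :
    subst f (br u) = br (subst f u) := mul_one _
@[simp] theorem subst_var (f : X → OpMon Z) (x : X) : subst f (var x) = f x := mul_one _

end OpMon

/-- The map `φ ↦ φ(u)` as a linear map. -/
def OpPoly.substLin (k : Type*) [Field k] {X Z : Type*} (u : X → OpMon Z) :
    OpPoly k X →ₗ[k] OpPoly k Z :=
  MonoidAlgebra.mapDomainLinearMap k k (OpMon.subst u)

@[simp] theorem OpPoly.substLin_mon (u : X → OpMon Z) (m : OpMon X) :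
    OpPoly.substLin k u (mon k m) = mon k (OpMon.subst u m) := by
  simp [substLin, mon]

theorem substSet_singleton (φ : OpPoly k X) :
    substSet {φ} (Set.univ : Set (OpMon Z)) = Set.range fun u => OpPoly.substLin k u φ := by
  ext f
  simp only [substSet, Set.mem_singleton_iff, Set.mem_univ, implies_true, true_and,
    exists_eq_left, Set.mem_ofPred_eq, Set.mem_range]
  exact exists_congr fun u => eq_comm

end Substitution

/-! ### Rules with leading monomial $\lfloor u\rfloor$. -/

section Unary

variable {k : Type*} [Field k] {Z : Type*} {le : OpMon Z → OpMon Z → Prop}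

/-- A linear family `Φ(u)` with leading monomials `⌊u⌋` is a Gröbner–Shirshov basis if the
substitution of an element of its ideal into the remainder is trivial. -/
theorem isOperatedGSBasis_unary (hle : IsMonomialOrder le) {ι : Type*} (x : ι → OpMon Z)
    (Φ : OpPoly k Z →ₗ[k] OpPoly k Z) {good : OpMon Z → Prop}
    (hx : ∀ u, Φ (mon k u) ∈ Set.range fun i => Φ (mon k (x i)))
    (hzero : ∀ u, ¬ good u → Φ (mon k u) = 0)
    (hlead : ∀ u, good u → Φ (mon k u) - mon k (br u) ∈ below k le (br u))
    (hR : ∀ u, u ≠ 1 → ∀ p ∈ idealLE le (Set.range fun i => Φ (mon k (x i))) u,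
      Φ p - opBr p ∈ idealLT le (Set.range fun i => Φ (mon k (x i))) (br u)) :
    IsOperatedGSBasis le (Set.range fun i => Φ (mon k (x i))) := by
  have hΦ (m) : Φ (mon k m) ∈ idealLE le (Set.range fun i => Φ (mon k (x i))) (br m) := by
    by_cases hm : good m
    · exact mem_idealLE_of_sub_mem hle (hx m) (hlead m hm)
    · rw [hzero m hm]
      exact zero_mem _
  refine isOperatedGSBasis_range hle (L := fun i => br (x i)) (good := fun i => good (x i))
    (fun i hi => hzero _ hi) (fun i hi => hlead _ hi) ?_ ?_
  -- Leading monomials have breadth one, so there is no proper overlap.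
  · intro i j _ _ u v _ hu _ hb
    exact absurd (breadth_eq_zero.1 (by simpa using hb)) hu
  · intro i j _ hj q hq
    rcases StarWord.plug_eq_br (br_ne_one _) hq with ⟨h, hq⟩ | ⟨q', h, hq⟩
    · simp only [StarWord.plugLin_eq_self hq, br_injective h, sub_self, zero_mem]
    · have h0 : ∀ u : OpMon Z, (StarWord.inBr (.star 1) 1).plug u = br u := by simp [br]
      have h1 : ∀ p : OpPoly k Z, (StarWord.inBr (.star 1) 1).plugLin k p = opBr p := fun p => by
        rw [StarWord.plugLin_eq_opBr (r := .star 1) (by simp [br]),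
          StarWord.plugLin_eq_self (by simp)]
      have := sub_plugLin_mem_idealLT hle (.inBr (.star 1) 1) q' (hlead _ hj)
        (by simpa only [h0] using hΦ) (by
          rw [h0, h1]
          refine hR _ ?_ _ (plugLin_mem_idealLE hle q' (hΦ _))
          exact fun h => br_ne_one _ (StarWord.eq_one_of_plug_eq_one h))
      rwa [h0, h1, h, ← StarWord.plugLin_eq_opBr hq] at this

end Unary

/-! ### The algebraic identity behind (U1'_a) and (U2'_a). -/

section DiffProd

variable {k : Type*} [Field k] {Z : Type*}

/-- The polynomial `⌊X⌋⌊Y⌋ - a (X⌊Y⌋ + ⌊X⌋Y) + b ⌊X ∘ Y⌋ + a² XY - a b X ∘ Y` for a bilinear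
operation `∘`. -/
def diffProd (a b : k) (M : OpPoly k Z →ₗ[k] OpPoly k Z →ₗ[k] OpPoly k Z) :
    OpPoly k Z →ₗ[k] OpPoly k Z →ₗ[k] OpPoly k Z :=
  LinearMap.mk₂ k (fun X Y => opBr X * opBr Y - a • (X * opBr Y + opBr X * Y) + b • opBr (M X Y)
      + a ^ 2 • (X * Y) - (a * b) • M X Y)
    (fun _ _ _ => by simp only [map_add, LinearMap.add_apply, add_mul]; module)
    (fun _ _ _ => by simp only [map_smul, LinearMap.smul_apply, smul_mul_assoc]; module)
    (fun _ _ _ => by simp only [map_add, mul_add]; module)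
    (fun _ _ _ => by simp only [map_smul, mul_smul_comm]; module)

theorem diffProd_apply (a b : k) (M : OpPoly k Z →ₗ[k] OpPoly k Z →ₗ[k] OpPoly k Z)
    (X Y : OpPoly k Z) : diffProd a b M X Y = opBr X * opBr Y - a • (X * opBr Y + opBr X * Y)
      + b • opBr (M X Y) + a ^ 2 • (X * Y) - (a * b) • M X Y := rfl

/-- With $D=\lfloor\cdot\rfloor-a$ the polynomial is $f(X,Y)=D(X)D(Y)+bD(X\circ Y)$. In
$f(X,Y)D(W)-D(X)f(Y,W)$ the triple products cancel, and associativity of $\circ$ cancels the terms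
$b^2D(X\circ Y\circ W)$. Expanding the outer $D(W)$ and $D(X)$ gives the formula. -/
theorem diffProd_intersection (a b : k) (M : OpPoly k Z →ₗ[k] OpPoly k Z →ₗ[k] OpPoly k Z)
    (hM : ∀ X Y W, M (M X Y) W = M X (M Y W)) (X Y W : OpPoly k Z) :
    diffProd a b M X Y * opBr W - opBr X * diffProd a b M Y W =
      a • (diffProd a b M X Y * W) - a • (X * diffProd a b M Y W)
        + b • diffProd a b M (M X Y) W - b • diffProd a b M X (M Y W) := by
  simp only [diffProd_apply, mul_add, add_mul, mul_sub, sub_mul, smul_mul_assoc, mul_smul_comm,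
    smul_add, smul_sub, smul_smul, mul_assoc, hM]
  module

end DiffProd

/-! ### The rules that are GS with respect to $\le_{\rm db}$. -/

section Db

variable {k : Type*} [Field k] {Z : Type*} [LinearOrder Z]

theorem dbLe_lt_of_degP_lt {u v : OpMon Z} (h : u.degP < v.degP) : DbLe u v ∧ u ≠ v :=
  ⟨.inr (.degP h), fun he => h.ne (he ▸ rfl)⟩

variable [WellFoundedLT Z]

/-- All instances are monomials, so both kinds of composition vanish identically. -/
theorem isGSOn_U5c : IsGSOn (DbLe (Z := Z)) {UDiff.U5c k} := by
  refine ⟨dbLe_isMonomialOrder, ?_⟩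
  rw [substSet_singleton]
  have h (u : Fin 2 → OpMon Z) : OpPoly.substLin k u (UDiff.U5c k) = mon k (u 0) := by
    simp [UDiff.U5c, UDiff.x]
  simp only [h]
  refine isOperatedGSBasis_range dbLe_isMonomialOrder (L := fun u => u 0) (good := fun _ => True)
    (by simp) (by simp) ?_ ?_
  · intro i j _ _ u v h _ _ _
    simp [← mon_mul, h]
  · intro i j _ _ q hq
    simp [hq]

theorem isGSOn_U1c (a : k) : IsGSOn (DbLe (Z := Z)) {UDiff.U1c a} := by
  refine ⟨dbLe_isMonomialOrder, ?_⟩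
  rw [substSet_singleton]
  have h (u : Fin 2 → OpMon Z) : OpPoly.substLin k u (UDiff.U1c a) =
      (opBr - a • LinearMap.id : OpPoly k Z →ₗ[k] OpPoly k Z) (mon k (u 0)) := by
    simp [UDiff.U1c, UDiff.x]
  simp only [h]
  have hlt (u : OpMon Z) : DbLe u (br u) ∧ u ≠ br u := dbLe_lt_of_degP_lt (by simp)
  refine isOperatedGSBasis_unary dbLe_isMonomialOrder (fun u : Fin 2 → OpMon Z => u 0) _
    (good := fun _ => True) (fun u => ⟨fun _ => u, rfl⟩) (by simp) (fun u _ => ?_) ?_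
  · simpa using neg_mem (Submodule.smul_mem _ a (mon_mem_below (hlt u)))
  · intro u _ p hp
    simpa using neg_mem (Submodule.smul_mem _ a
      (idealLE_le_idealLT dbLe_isMonomialOrder (hlt u) hp))

/-- All terms except $\lfloor u\rfloor\lfloor v\rfloor$ have smaller $P$-degree, so triviality is
checked by counting brackets. `hleft` and `hright` say that $\circ$ respects the filtered ideals,
which is needed for the terms containing $X\circ Y$. -/
theorem isOperatedGSBasis_diffProd (a b : k)
    (M : OpPoly k Z →ₗ[k] OpPoly k Z →ₗ[k] OpPoly k Z) (m : OpMon Z → OpMon Z → OpMon Z)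
    (hassoc : ∀ X Y W, M (M X Y) W = M X (M Y W))
    (hmon : ∀ u v, M (mon k u) (mon k v) = mon k (m u v))
    (hdeg : ∀ u v, (m u v).degP = u.degP + v.degP)
    (hleft : ∀ (G : Set (OpPoly k Z)) u v, ∀ p ∈ idealLE DbLe G u,
      M p (mon k v) ∈ idealLE DbLe G (m u v))
    (hright : ∀ (G : Set (OpPoly k Z)) u v, ∀ p ∈ idealLE DbLe G v,
      M (mon k u) p ∈ idealLE DbLe G (m u v)) :
    IsOperatedGSBasis DbLe
      (Set.range fun u : Fin 2 → OpMon Z => diffProd a b M (mon k (u 0)) (mon k (u 1))) := by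
  have hle := dbLe_isMonomialOrder (Z := Z)
  set G := Set.range fun u : Fin 2 → OpMon Z => diffProd a b M (mon k (u 0)) (mon k (u 1))
  have hlead (u v : OpMon Z) : diffProd a b M (mon k u) (mon k v) - mon k (br u * br v) ∈
      below k DbLe (br u * br v) := by
    have : diffProd a b M (mon k u) (mon k v) - mon k (br u * br v) =
        -(a • (mon k (u * br v) + mon k (br u * v))) + b • mon k (br (m u v))
          + a ^ 2 • mon k (u * v) - (a * b) • mon k (m u v) := by
      simp only [diffProd_apply, hmon, opBr_mon, mon_mul]
      abel
    rw [this]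
    have H (w : OpMon Z) (hw : w.degP < (br u * br v).degP) :
        mon k w ∈ below k DbLe (br u * br v) := mon_mem_below (dbLe_lt_of_degP_lt hw)
    refine sub_mem (add_mem (add_mem (neg_mem (Submodule.smul_mem _ _ (add_mem ?_ ?_)))
      (Submodule.smul_mem _ _ ?_)) (Submodule.smul_mem _ _ ?_)) (Submodule.smul_mem _ _ ?_) <;>
    · apply H
      simp [hdeg]
      try omega
  have hmem (u v : OpMon Z) : diffProd a b M (mon k u) (mon k v) ∈
      idealLE DbLe G (br u * br v) :=
    mem_idealLE_of_sub_mem hle ⟨![u, v], by simp⟩ (hlead u v)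
  have hlt {p : OpPoly k Z} {u w : OpMon Z} (hp : p ∈ idealLE DbLe G u) (h : u.degP < w.degP) :
      p ∈ idealLT DbLe G w := idealLE_le_idealLT hle (dbLe_lt_of_degP_lt h) hp
  refine isOperatedGSBasis_range hle (L := fun u => br (u 0) * br (u 1)) (good := fun _ => True)
    (by simp) (fun u _ => hlead _ _) ?_ ?_
  · intro i j _ _ u v h hu hv hb
    have hu' := mt breadth_eq_zero.1 hu
    have hl := congrArg breadth h
    simp only [breadth_mul, breadth_br] at hl hb
    rw [mul_assoc] at h
    -- Both cofactors have breadth one, so $w$ consists of three brackets and the overlap is the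
    -- middle one.
    obtain ⟨e, h1, h2⟩ := exists_suffix h (by simp; omega)
    have hl1 := congrArg breadth h1
    simp only [breadth_mul, breadth_br] at hl1
    obtain rfl : e = 1 := breadth_eq_zero.1 (by omega)
    rw [mul_one] at h1
    simp only [one_mul, br_mul, brCons.injEq] at h2
    obtain ⟨h2, rfl⟩ := h2
    subst h1
    simp only [← opBr_mon]
    rw [← h2, diffProd_intersection a b M hassoc]
    simp only [hmon]
    refine sub_mem (add_mem (sub_mem ?_ ?_) ?_) ?_ <;> refine Submodule.smul_mem _ _ ?_
    · exact hlt (mul_mem_idealLE hle (hmem _ _) _) (by simp)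
    · exact hlt (mon_mul_mem_idealLE hle (hmem _ _) _) (by simp [h2])
    · exact hlt (hmem _ _) (by simp [hdeg, h2]; omega)
    · exact hlt (hmem _ _) (by simp [hdeg, h2]; omega)
  · intro i j _ _ q hq
    have hs : br (j 0) * br (j 1) ≠ 1 := by simp
    have hb (u : OpMon Z) : br (j 0) * br (j 1) ≠ br u := fun h => by
      have := congrArg breadth h
      simp at this
    rcases StarWord.plug_eq_mul hs hq with ⟨q', h1, h2⟩ | ⟨q', h1, h2⟩ |
      ⟨s, s₁, s₂, s', h1, h2, h3, h4, h5, h6⟩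
    · obtain ⟨h, -⟩ | ⟨r, h3, h4⟩ := StarWord.plug_eq_br hs h1
      · exact absurd h (hb _)
      have h0 (x : OpMon Z) : (StarWord.inBr (.star 1) (br (i 1))).plug x = br x * br (i 1) := by
        simp
      have h0' (p : OpPoly k Z) : (StarWord.inBr (.star 1) (br (i 1))).plugLin k p =
          opBr p * mon k (br (i 1)) := by
        rw [StarWord.plugLin_eq_mul (a := 1) (b := br (i 1)) (r := .inBr (.star 1) 1)
          (by simp), StarWord.plugLin_eq_opBr (r := .star 1) (by simp [br]),
          StarWord.plugLin_eq_self (by simp), mon_one, one_mul]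
      -- The occurrence lies inside the first bracket, so the second argument is frozen and `Φ` is
      -- linear in the first.
      have := sub_plugLin_mem_idealLT (Φ := (diffProd a b M).flip (mon k (i 1))) hle
        (.inBr (.star 1) (br (i 1))) r (hlead (j 0) (j 1))
        (fun u => by simpa only [h0, LinearMap.flip_apply] using hmem u (i 1)) (by
          have hp := plugLin_mem_idealLE hle r (hmem (j 0) (j 1))
          rw [h0, h0', LinearMap.flip_apply, diffProd_apply, ← opBr_mon]
          generalize StarWord.plugLin k r _ = p at hp
          generalize r.plug _ = u at hp
          rw [show ∀ A B C D E : OpPoly k Z, A - B + C + D - E - A = -B + C + D - E by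
            intros; abel]
          refine sub_mem (add_mem (add_mem (neg_mem (Submodule.smul_mem _ _ (add_mem ?_ ?_)))
            (Submodule.smul_mem _ _ ?_)) (Submodule.smul_mem _ _ ?_)) (Submodule.smul_mem _ _ ?_)
          · rw [opBr_mon]
            exact hlt (mul_mem_idealLE hle hp _) (by simp)
          · exact hlt (mul_mem_idealLE hle (opBr_mem_idealLE hle hp) _) (by simp)
          · exact hlt (opBr_mem_idealLE hle (hleft _ _ _ _ hp)) (by simp [hdeg]; omega)
          · exact hlt (mul_mem_idealLE hle hp _) (by simp; omega)
          · exact hlt (hleft _ _ _ _ hp) (by simp [hdeg]; omega))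
      rw [h0, h3, LinearMap.flip_apply] at this
      rwa [StarWord.plugLin_eq_comp (r := .inBr (.star 1) (br (i 1))) (r' := r)
        (fun x => by rw [h2, h4, h0])]
    · obtain ⟨h, -⟩ | ⟨r, h3, h4⟩ := StarWord.plug_eq_br hs h1
      · exact absurd h (hb _)
      have h0 (x : OpMon Z) : (StarWord.brCons (i 0) (.inBr (.star 1) 1)).plug x =
          br (i 0) * br x := by
        simp [br]
      have h0' (p : OpPoly k Z) : (StarWord.brCons (i 0) (.inBr (.star 1) 1)).plugLin k p =
          mon k (br (i 0)) * opBr p := by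
        rw [StarWord.plugLin_eq_mul (a := br (i 0)) (b := 1) (r := .inBr (.star 1) 1)
          (by simp), StarWord.plugLin_eq_opBr (r := .star 1) (by simp [br]),
          StarWord.plugLin_eq_self (by simp), mon_one, mul_one]
      have := sub_plugLin_mem_idealLT (Φ := diffProd a b M (mon k (i 0))) hle
        (.brCons (i 0) (.inBr (.star 1) 1)) r (hlead (j 0) (j 1))
        (fun u => by simpa only [h0] using hmem (i 0) u) (by
          have hp := plugLin_mem_idealLE hle r (hmem (j 0) (j 1))
          rw [h0, h0', diffProd_apply, ← opBr_mon]
          generalize StarWord.plugLin k r _ = p at hp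
          generalize r.plug _ = u at hp
          rw [show ∀ A B C D E : OpPoly k Z, A - B + C + D - E - A = -B + C + D - E by
            intros; abel]
          refine sub_mem (add_mem (add_mem (neg_mem (Submodule.smul_mem _ _ (add_mem ?_ ?_)))
            (Submodule.smul_mem _ _ ?_)) (Submodule.smul_mem _ _ ?_)) (Submodule.smul_mem _ _ ?_)
          · exact hlt (mon_mul_mem_idealLE hle (opBr_mem_idealLE hle hp) _) (by simp)
          · rw [opBr_mon]
            exact hlt (mon_mul_mem_idealLE hle hp _) (by simp)
          · exact hlt (opBr_mem_idealLE hle (hright _ _ _ _ hp)) (by simp [hdeg]; omega)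
          · exact hlt (mon_mul_mem_idealLE hle hp _) (by simp; omega)
          · exact hlt (hright _ _ _ _ hp) (by simp [hdeg]; omega))
      rw [h0, h3] at this
      rwa [StarWord.plugLin_eq_comp (r := .brCons (i 0) (.inBr (.star 1) 1)) (r' := r)
        (fun x => by rw [h2, h4, h0])]
    -- An occurrence meeting both brackets is the whole word, and the two polynomials coincide.
    · have hb4 := congrArg breadth h4
      have hb5 := congrArg breadth h5
      have hb1 := mt breadth_eq_zero.1 h1
      have hb2 := mt breadth_eq_zero.1 h2
      simp only [breadth_mul, breadth_br] at hb4 hb5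
      obtain rfl : s = 1 := breadth_eq_zero.1 (by omega)
      obtain rfl : s' = 1 := breadth_eq_zero.1 (by omega)
      rw [one_mul] at h4
      rw [mul_one] at h5
      rw [← h4, ← h5] at h3
      simp only [br_mul, brCons.injEq] at h3
      rw [StarWord.plugLin_eq_self (by simpa using h6), h3.1, br_injective h3.2, sub_self]
      exact zero_mem _

theorem isGSOn_U1a (a b c : k) (h : a ^ 2 = a * b + c) :
    IsGSOn (DbLe (Z := Z)) {UDiff.U1a a b c} := by
  have hle := dbLe_isMonomialOrder (Z := Z)
  refine ⟨hle, ?_⟩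
  rw [substSet_singleton]
  have h (u : Fin 2 → OpMon Z) : OpPoly.substLin k u (UDiff.U1a a b c) =
      diffProd a b (LinearMap.mul k _) (mon k (u 0)) (mon k (u 1)) := by
    -- The relation between the scalars splits $c\,xy$ into $a^2xy-ab\,xy$, which is `diffProd` for
    -- the ordinary product.
    obtain rfl : c = a ^ 2 - a * b := by rw [h]; ring
    simp only [UDiff.U1a, UDiff.x, UDiff.y, map_add, map_sub, map_smul, OpPoly.substLin_mon,
      subst_mul, subst_br, subst_var, diffProd_apply, opBr_mon, ← mon_mul, LinearMap.mul_apply']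
    module
  simp only [h]
  exact isOperatedGSBasis_diffProd a b _ (· * ·) (fun X Y W => mul_assoc X Y W)
    (fun u v => (mon_mul u v).symm) (fun u v => degP_mul u v)
    (fun G u v p hp => mul_mem_idealLE hle hp v) (fun G u v p hp => mon_mul_mem_idealLE hle hp u)

/-- Here $\circ$ is the opposite product, which is associative as well. -/
theorem isGSOn_U2a (a b : k) : IsGSOn (DbLe (Z := Z)) {UDiff.U2a a b} := by
  have hle := dbLe_isMonomialOrder (Z := Z)
  refine ⟨hle, ?_⟩
  rw [substSet_singleton]
  have h (u : Fin 2 → OpMon Z) : OpPoly.substLin k u (UDiff.U2a a b) =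
      diffProd a b (LinearMap.mul k _).flip (mon k (u 0)) (mon k (u 1)) := by
    simp only [UDiff.U2a, UDiff.x, UDiff.y, map_add, map_sub, map_smul, OpPoly.substLin_mon,
      subst_mul, subst_br, subst_var, diffProd_apply, opBr_mon, ← mon_mul, LinearMap.mul_apply',
      LinearMap.flip_apply]
  simp only [h]
  exact isOperatedGSBasis_diffProd a b _ (fun u v => v * u)
    (fun X Y W => (mul_assoc W Y X).symm)
    (fun u v => (mon_mul v u).symm) (fun u v => (degP_mul v u).trans (add_comm _ _))
    (fun G u v p hp => mon_mul_mem_idealLE hle hp v) (fun G u v p hp => mul_mem_idealLE hle hp u)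

end Db

/-! ### The rules $x\lfloor y\rfloor-\lfloor xy\rfloor+\lfloor x\rfloor y-xEy$ and (U3') with
respect to $\le_{\rm udl}$. -/

section Udl

variable {k : Type*} [Field k] {Z : Type*}

/-- The polynomial `X⌊Y⌋ - ⌊XY⌋ + ⌊X⌋Y - X E Y`. -/
def derivRule (E : OpPoly k Z) : OpPoly k Z →ₗ[k] OpPoly k Z →ₗ[k] OpPoly k Z :=
  LinearMap.mk₂ k (fun X Y => X * opBr Y - opBr (X * Y) + opBr X * Y - X * E * Y)
    (fun _ _ _ => by simp only [map_add, add_mul]; abel)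
    (fun _ _ _ => by simp only [map_smul, smul_mul_assoc]; module)
    (fun _ _ _ => by simp only [map_add, mul_add]; abel)
    (fun _ _ _ => by simp only [map_smul, mul_smul_comm]; module)

theorem derivRule_apply (E X Y : OpPoly k Z) :
    derivRule E X Y = X * opBr Y - opBr (X * Y) + opBr X * Y - X * E * Y := rfl

/-- Let $f$ be the rule and $F=f(BS,V)$. The cocycle identity rewrites $Bf(S\lfloor V\rfloor P,T)$
through $f(BS\lfloor V\rfloor P,T)$. There $BS\lfloor V\rfloor=F+\lfloor BSV\rfloor-\lfloor
BS\rfloor V+BSEV$. Expanding $f(FP,T)$ cancels $FP\lfloor T\rfloor$. -/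
theorem derivRule_intersection (E B S V P T : OpPoly k Z) :
    derivRule E (B * S) V * (P * opBr T) - B * derivRule E (S * (opBr V * P)) T =
      -derivRule E (opBr (B * S * V) * P) T + derivRule E (opBr (B * S) * V * P) T
        - derivRule E (B * S * E * V * P) T + derivRule E B (S * opBr V * P * T)
        - derivRule E B (S * opBr V * P) * T + opBr (derivRule E (B * S) V * (P * T))
        - opBr (derivRule E (B * S) V * P) * T + derivRule E (B * S) V * P * E * T := by
  simp only [derivRule_apply, mul_add, add_mul, mul_sub, sub_mul, mul_assoc, map_add, map_sub]
  abel

/-- The Hochschild cocycle identity: $X\lfloor Y\rfloor-\lfloor XY\rfloor+\lfloor X\rfloor Y$ is the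
coboundary of the operator, and $XEY$ is itself a cocycle. -/
theorem derivRule_inclusion (E B S T : OpPoly k Z) :
    derivRule E (B * S) T - B * derivRule E S T =
      derivRule E B (S * T) - derivRule E B S * T := by
  simp only [derivRule_apply, mul_add, add_mul, mul_sub, sub_mul, mul_assoc]
  abel

theorem derivRule_mon (c : k) (e u v : OpMon Z) :
    derivRule (c • mon k e) (mon k u) (mon k v) =
      mon k (u * br v) - mon k (br (u * v)) + mon k (br u * v) - c • mon k (u * e * v) := by
  simp only [derivRule_apply, ← opBr_mon, mon_mul, mul_smul_comm, smul_mul_assoc]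

variable [LinearOrder Z] [WellFoundedLT Z]

theorem udlLe_lt_of_dlLt {u v : OpMon Z} (h : DlLt u.dagger v.dagger) : UdlLe u v ∧ u ≠ v :=
  ⟨udlLe_iff.2 (.inr h), fun he => dlLt_wf.irrefl.irrefl _ (he ▸ h)⟩

/-- $P$-degree and number of letters agree. Moving the left half bracket across `u` raises the
$G$-degree by the number of letters of `u.dagger`, which is positive. -/
theorem br_mul_lt {u v : OpMon Z} (hu : u ≠ 1) (hv : v ≠ 1) :
    UdlLe (br (u * v)) (u * br v) ∧ br (u * v) ≠ u * br v := by
  have h := degX_dagger_pos hu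
  have huv : u * v ≠ 1 := fun h => hu (mul_eq_one.1 h).1
  refine udlLe_lt_of_dlLt (.inr ⟨?_, .inr ⟨?_, .inl ?_⟩⟩) <;>
    simp only [dagger_mul, dagger_br huv, dagger_br hv, degP_mul, degP_br, degX_mul, degX_br,
      degG_mul, degG_br, mul_add]
  · ring
  · omega

theorem br_mul_self_lt {u v : OpMon Z} (hu : u ≠ 1) (hv : v ≠ 1) :
    UdlLe (br u * v) (u * br v) ∧ br u * v ≠ u * br v := by
  have h := degX_dagger_pos hu
  refine udlLe_lt_of_dlLt (.inr ⟨?_, .inr ⟨?_, .inl ?_⟩⟩) <;>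
    simp only [dagger_mul, dagger_br hu, dagger_br hv, degP_mul, degP_br, degX_mul, degX_br,
      degG_mul, degG_br, mul_add]
  · ring
  · omega

/-- As `v ≠ 1`, the bracket on `v` is not replaced by a letter, so removing it lowers the
$P$-degree. -/
theorem mul_mul_lt {u v e : OpMon Z} (he : e.dagger.degP = 0) (hv : v ≠ 1) :
    UdlLe (u * e * v) (u * br v) ∧ u * e * v ≠ u * br v := by
  refine udlLe_lt_of_dlLt (.inl ?_)
  simp only [dagger_mul, dagger_br hv, degP_mul, degP_br, he]
  omega

/-- The hypotheses common to the rules `x⌊y⌋ - ⌊xy⌋ + ⌊x⌋y - c x e y`. -/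
structure IsDerivRule (G : Set (OpPoly k Z)) (c : k) (e : OpMon Z) : Prop where
  degP_eq : e.dagger.degP = 0
  mem : ∀ u v, derivRule (c • mon k e) (mon k u) (mon k v) ∈ idealLE UdlLe G (u * br v)

variable {G : Set (OpPoly k Z)} {c : k} {e : OpMon Z}

theorem derivRule_sub_mem_below (c : k) (he : e.dagger.degP = 0) {u v : OpMon Z} (hu : u ≠ 1)
    (hv : v ≠ 1) : derivRule (c • mon k e) (mon k u) (mon k v) - mon k (u * br v) ∈
      below k UdlLe (u * br v) := by
  rw [derivRule_mon, show ∀ A B C D : OpPoly k Z, A - B + C - D - A = -B + C - D by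
    intros; abel]
  exact sub_mem (add_mem (neg_mem (mon_mem_below (br_mul_lt hu hv)))
    (mon_mem_below (br_mul_self_lt hu hv)))
    (Submodule.smul_mem _ _ (mon_mem_below (mul_mul_lt he hv)))

namespace IsDerivRule

theorem nested_left (hG : IsDerivRule G c e) {q : StarWord Z} {g : OpPoly k Z}
    {l v : OpMon Z} (hl1 : l ≠ 1) (hg : g ∈ G) (hl : g - mon k l ∈ below k UdlLe l)
    (hv : v ≠ 1) :
    derivRule (c • mon k e) (mon k (q.plug l)) (mon k v) - q.plugLin k g * mon k (br v) ∈
      idealLT UdlLe G (q.plug l * br v) := by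
  have hle := udlLe_isMonomialOrder (Z := Z)
  have h0 (x : OpMon Z) : (StarWord.star (br v)).plug x = x * br v := rfl
  have h0' (p : OpPoly k Z) : (StarWord.star (br v)).plugLin k p = p * mon k (br v) := by
    rw [StarWord.plugLin_eq_mul_id (a := 1) (b := br v) (by simp), mon_one, one_mul]
  have := sub_plugLin_mem_idealLT (Φ := (derivRule (c • mon k e)).flip (mon k v)) hle
    (.star (br v)) q hl (fun u => hG.mem u v) (by
      have hp := plugLin_mem_idealLE hle q (mem_idealLE_of_sub_mem hle hg hl)
      have hu : q.plug l ≠ 1 := fun h => hl1 (StarWord.eq_one_of_plug_eq_one h)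
      rw [h0, h0', LinearMap.flip_apply, derivRule_apply, ← opBr_mon]
      generalize StarWord.plugLin k q _ = p at hp
      generalize q.plug _ = u at hp hu
      rw [show ∀ A B C D : OpPoly k Z, A - B + C - D - A = -B + C - D by intros; abel,
        mul_smul_comm, smul_mul_assoc]
      refine sub_mem (add_mem (neg_mem ?_) ?_) (Submodule.smul_mem _ _ ?_)
      · exact idealLE_le_idealLT hle (br_mul_lt hu hv)
          (opBr_mem_idealLE hle (mul_mem_idealLE hle hp _))
      · exact idealLE_le_idealLT hle (br_mul_self_lt hu hv)
          (mul_mem_idealLE hle (opBr_mem_idealLE hle hp) _)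
      · exact idealLE_le_idealLT hle (mul_mul_lt hG.degP_eq hv)
          (mul_mem_idealLE hle (mul_mem_idealLE hle hp _) _))
  rwa [h0, h0', LinearMap.flip_apply] at this

theorem nested_right (hG : IsDerivRule G c e) {q : StarWord Z} {g : OpPoly k Z}
    {l u : OpMon Z} (hl1 : l ≠ 1) (hg : g ∈ G) (hl : g - mon k l ∈ below k UdlLe l)
    (hu : u ≠ 1) :
    derivRule (c • mon k e) (mon k u) (mon k (q.plug l)) - mon k u * opBr (q.plugLin k g) ∈
      idealLT UdlLe G (u * br (q.plug l)) := by
  have hle := udlLe_isMonomialOrder (Z := Z)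
  have h0 (x : OpMon Z) : (StarWord.lmul u (.inBr (.star 1) 1)).plug x = u * br x := by
    simp [br]
  have h0' (p : OpPoly k Z) : (StarWord.lmul u (.inBr (.star 1) 1)).plugLin k p =
      mon k u * opBr p := by
    rw [StarWord.plugLin_eq_mul (a := u) (b := 1) (r := .inBr (.star 1) 1) (by simp),
      StarWord.plugLin_eq_opBr (r := .star 1) (by simp [br]),
      StarWord.plugLin_eq_self (by simp), mon_one, mul_one]
  have := sub_plugLin_mem_idealLT (Φ := derivRule (c • mon k e) (mon k u)) hle
    (.lmul u (.inBr (.star 1) 1)) q hl (fun v => by rw [h0]; exact hG.mem u v) (by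
      have hp := plugLin_mem_idealLE hle q (mem_idealLE_of_sub_mem hle hg hl)
      have hv : q.plug l ≠ 1 := fun h => hl1 (StarWord.eq_one_of_plug_eq_one h)
      rw [h0, h0', derivRule_apply]
      generalize StarWord.plugLin k q _ = p at hp
      generalize q.plug _ = v at hp hv
      rw [show ∀ A B C D : OpPoly k Z, A - B + C - D - A = -B + C - D by intros; abel,
        mul_smul_comm, smul_mul_assoc, opBr_mon, ← mon_mul]
      refine sub_mem (add_mem (neg_mem ?_) ?_) (Submodule.smul_mem _ _ ?_)
      · exact idealLE_le_idealLT hle (br_mul_lt hu hv)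
          (opBr_mem_idealLE hle (mon_mul_mem_idealLE hle hp _))
      · exact idealLE_le_idealLT hle (br_mul_self_lt hu hv) (mon_mul_mem_idealLE hle hp _)
      · exact idealLE_le_idealLT hle (mul_mul_lt hG.degP_eq hv)
          (mon_mul_mem_idealLE hle hp _))
  rwa [h0, h0'] at this

theorem intersection (hG : IsDerivRule G c e) {b s v p t : OpMon Z} (hb : b ≠ 1)
    (hv : v ≠ 1) (ht : t ≠ 1) :
    derivRule (c • mon k e) (mon k (b * s)) (mon k v) * mon k (p * br t) -
        mon k b * derivRule (c • mon k e) (mon k (s * (br v * p))) (mon k t) ∈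
      idealLT UdlLe G (b * s * br v * (p * br t)) := by
  have hle := udlLe_isMonomialOrder (Z := Z)
  have ne_left {x y : OpMon Z} (h : x ≠ 1) : x * y ≠ 1 := fun h' => h (mul_eq_one.1 h').1
  have ne_right {x y : OpMon Z} (h : y ≠ 1) : x * y ≠ 1 := fun h' => h (mul_eq_one.1 h').2
  have hbs : b * s ≠ 1 := ne_left hb
  have hy : s * br v * p ≠ 1 := ne_left (ne_right (br_ne_one _))
  have hby : b * s * br v * p ≠ 1 := ne_left (ne_right (br_ne_one _))
  have hF := hG.mem (b * s) v
  have key := derivRule_intersection (c • mon k e) (mon k b) (mon k s) (mon k v) (mon k p)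
    (mon k t)
  simp only [opBr_mon, ← mon_mul, mul_smul_comm, smul_mul_assoc, map_smul,
    LinearMap.smul_apply] at key
  rw [key, ← mul_assoc (b * s * br v)]
  refine add_mem (sub_mem (add_mem (sub_mem (add_mem (sub_mem (add_mem (neg_mem ?_) ?_)
    (Submodule.smul_mem _ _ ?_)) ?_) ?_) ?_) ?_) (Submodule.smul_mem _ _ ?_)
  -- The first three instances arise when $bs\lfloor v\rfloor$ in $w$ is replaced by a smaller
  -- monomial of the first polynomial; the next two when the tail $s\lfloor v\rfloor p\lfloor
  -- t\rfloor$ is lowered. The last three are multiples of the first polynomial itself.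
  · refine idealLE_le_idealLT hle ?_ (hG.mem _ _)
    exact hle.mul_right_lt (hle.mul_right_lt (br_mul_lt hbs hv) p) (br t)
  · refine idealLE_le_idealLT hle ?_ (hG.mem _ _)
    exact hle.mul_right_lt (hle.mul_right_lt (br_mul_self_lt hbs hv) p) (br t)
  · refine idealLE_le_idealLT hle ?_ (hG.mem _ _)
    exact hle.mul_right_lt (hle.mul_right_lt (mul_mul_lt hG.degP_eq hv) p) (br t)
  · refine idealLE_le_idealLT hle ?_ (hG.mem _ _)
    simpa only [mul_assoc] using hle.mul_left_lt (br_mul_lt hy ht) b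
  · refine idealLE_le_idealLT hle ?_ (mul_mem_idealLE hle (hG.mem _ _) _)
    simpa only [mul_assoc] using hle.mul_left_lt (br_mul_self_lt hy ht) b
  · refine idealLE_le_idealLT hle ?_ (opBr_mem_idealLE hle (mul_mem_idealLE hle hF _))
    simpa only [mul_assoc] using br_mul_lt hby ht
  · refine idealLE_le_idealLT hle ?_
      (mul_mem_idealLE hle (opBr_mem_idealLE hle (mul_mem_idealLE hle hF _)) _)
    exact br_mul_self_lt hby ht
  · refine idealLE_le_idealLT hle ?_
      (mul_mem_idealLE hle (mul_mem_idealLE hle (mul_mem_idealLE hle hF _) _) _)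
    exact mul_mul_lt hG.degP_eq ht

/-- Intersection compositions of two instances with nontrivial arguments. -/
theorem intersection' (hG : IsDerivRule G c e) {u v s t x y : OpMon Z}
    (hv : v ≠ 1) (ht : t ≠ 1) (h : u * br v * x = y * (s * br t)) (hx : x ≠ 1) (hy : y ≠ 1)
    (hl : x.breadth < (s * br t).breadth) :
    derivRule (c • mon k e) (mon k u) (mon k v) * mon k x -
        mon k y * derivRule (c • mon k e) (mon k s) (mon k t) ∈
      idealLT UdlLe G (u * br v * x) := by
  have hx' := mt breadth_eq_zero.1 hx
  rw [← mul_assoc] at h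
  -- Both final brackets are located in $w$: $x=p\lfloor t\rfloor$, $s=s'\lfloor v\rfloor p$ and
  -- $u=ys'$.
  obtain ⟨p, h1, rfl⟩ := exists_suffix h.symm (by simp; omega)
  rw [mul_assoc] at h1
  simp only [breadth_mul, breadth_br] at hl
  obtain ⟨s', rfl, rfl⟩ := exists_suffix h1.symm (by simp; omega)
  exact hG.intersection hy hv ht

/-- Inclusion compositions of two instances with nontrivial arguments. -/
theorem inclusion (hG : IsDerivRule G c e) {u v s t : OpMon Z} {q : StarWord Z}
    (hu : u ≠ 1) (hv : v ≠ 1) (hs : s ≠ 1) (ht : t ≠ 1)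
    (hg : derivRule (c • mon k e) (mon k s) (mon k t) ∈ G)
    (h : q.plug (s * br t) = u * br v) :
    derivRule (c • mon k e) (mon k u) (mon k v) -
        q.plugLin k (derivRule (c • mon k e) (mon k s) (mon k t)) ∈
      idealLT UdlLe G (u * br v) := by
  have hle := udlLe_isMonomialOrder (Z := Z)
  have hl := derivRule_sub_mem_below (k := k) c hG.degP_eq hs ht
  have hst : s * br t ≠ 1 := fun h => hs (mul_eq_one.1 h).1
  rcases StarWord.plug_eq_mul hst h with ⟨q', rfl, h2⟩ | ⟨q', h1, h2⟩ |
    ⟨b, s₁, s₂, s', h1, h2, h3, h4, h5, h6⟩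
  · rw [StarWord.plugLin_eq_mul (r := q') (a := 1) (b := br v) (by simpa using h2), mon_one,
      one_mul]
    exact hG.nested_left hst hg hl hv
  · rcases StarWord.plug_eq_br hst h1 with ⟨h1, -⟩ | ⟨r, rfl, h3⟩
    · have := congrArg breadth h1
      have := mt breadth_eq_zero.1 hs
      simp only [breadth_mul, breadth_br] at *
      omega
    · rw [StarWord.plugLin_eq_mul (r := q') (a := u) (b := 1) (by simpa using h2), mon_one,
        mul_one, StarWord.plugLin_eq_opBr h3]
      exact hG.nested_right hst hg hl hu
  · have hb5 := congrArg breadth h5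
    have hb2 := mt breadth_eq_zero.1 h2
    simp only [breadth_mul, breadth_br] at hb5
    obtain rfl : s' = 1 := breadth_eq_zero.1 (by omega)
    rw [mul_one] at h5
    subst h5
    -- The occurrence ends with the bracket $\lfloor v\rfloor$, so it is a final segment: `t = v`
    -- and `u = b * s`.
    obtain ⟨e', rfl, h7⟩ := exists_suffix h3 (by simp)
    have hb7 := congrArg breadth h7
    simp only [breadth_mul, breadth_br] at hb7
    obtain rfl : e' = 1 := breadth_eq_zero.1 (by omega)
    rw [one_mul] at h7
    obtain rfl := br_injective h7
    rw [mul_one] at hs ⊢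
    subst h4
    rw [StarWord.plugLin_eq_mul_id h6, mon_one, mul_one]
    by_cases hb : b = 1
    · subst hb
      rw [mon_one, one_mul, one_mul, sub_self]
      exact zero_mem _
    · rw [mon_mul, derivRule_inclusion, ← mon_mul, mul_assoc]
      refine sub_mem ?_ ?_
      · exact idealLE_le_idealLT hle (hle.mul_left_lt (br_mul_lt hs hv) b) (hG.mem _ _)
      · refine idealLE_le_idealLT hle ?_ (mul_mem_idealLE hle (hG.mem _ _) _)
        simpa only [mul_assoc] using hle.mul_left_lt (br_mul_self_lt hs hv) b

end IsDerivRule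

/-- Instances with an argument `1` vanish, so only nontrivial arguments with leading monomial
$u\lfloor v\rfloor$ matter. -/
theorem isGSOn_U5b : IsGSOn (UdlLe (Z := Z)) {UDiff.U5b k} := by
  have hle := udlLe_isMonomialOrder (Z := Z)
  refine ⟨hle, ?_⟩
  rw [substSet_singleton]
  have h (u : Fin 2 → OpMon Z) : OpPoly.substLin k u (UDiff.U5b k) =
      derivRule ((1 : k) • mon k (br 1)) (mon k (u 0)) (mon k (u 1)) := by
    rw [derivRule_mon]
    simp only [UDiff.U5b, UDiff.x, UDiff.y, map_add, map_sub, OpPoly.substLin_mon, subst_mul,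
      subst_br, subst_var, subst_one, one_smul]
  simp only [h]
  have hd : (br 1 : OpMon Z).dagger.degP = 0 := by simp
  have hzero (u v : OpMon Z) (huv : ¬ (u ≠ 1 ∧ v ≠ 1)) :
      derivRule ((1 : k) • mon k (br 1)) (mon k u) (mon k v) = 0 := by
    by_cases hu : u = 1
    · subst hu
      rw [derivRule_mon]
      simp only [one_mul, one_smul]
      abel
    · obtain rfl : v = 1 := by_contra fun hv => huv ⟨hu, hv⟩
      rw [derivRule_mon]
      simp only [mul_one, one_smul]
      abel
  have hG : IsDerivRule (Set.range fun u : Fin 2 → OpMon Z =>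
      derivRule ((1 : k) • mon k (br 1)) (mon k (u 0)) (mon k (u 1))) (1 : k) (br 1) := by
    refine ⟨hd, fun u v => ?_⟩
    by_cases huv : u ≠ 1 ∧ v ≠ 1
    · exact mem_idealLE_of_sub_mem hle ⟨![u, v], by simp⟩
        (derivRule_sub_mem_below _ hd huv.1 huv.2)
    · rw [hzero u v huv]
      exact zero_mem _
  refine isOperatedGSBasis_range hle (L := fun u => u 0 * br (u 1))
    (good := fun u => u 0 ≠ 1 ∧ u 1 ≠ 1) (fun u => hzero _ _)
    (fun u hu => derivRule_sub_mem_below _ hd hu.1 hu.2) ?_ ?_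
  · intro i j hi hj u v h hu hv hl
    exact hG.intersection' hi.2 hj.2 h hu hv hl
  · intro i j hi hj q hq
    exact hG.inclusion hi.1 hi.2 hj.1 hj.2 ⟨j, rfl⟩ hq

/-- The instance at `1` is zero. For $u\ne1$ the monomials $u\lfloor1\rfloor$ and $\lfloor1\rfloor
u$ lie below $\lfloor u\rfloor$ because $\lfloor1\rfloor$ counts as a letter. -/
theorem isGSOn_U3 (a : k) : IsGSOn (UdlLe (Z := Z)) {UDiff.U3 a} := by
  have hle := udlLe_isMonomialOrder (Z := Z)
  refine ⟨hle, ?_⟩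
  rw [substSet_singleton]
  have h (u : Fin 2 → OpMon Z) : OpPoly.substLin k u (UDiff.U3 a) =
      (opBr + a • LinearMap.mulRight k (mon k (br 1)) -
        (a + 1) • LinearMap.mulLeft k (mon k (br 1)) : OpPoly k Z →ₗ[k] OpPoly k Z)
        (mon k (u 0)) := by
    simp only [UDiff.U3, UDiff.x, map_add, map_sub, map_smul, OpPoly.substLin_mon, subst_mul,
      subst_br, subst_var, subst_one, LinearMap.sub_apply, LinearMap.add_apply,
      LinearMap.smul_apply, LinearMap.mulRight_apply, LinearMap.mulLeft_apply, opBr_mon, ← mon_mul]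
  simp only [h]
  have hlt1 {u : OpMon Z} (hu : u ≠ 1) : UdlLe (u * br 1) (br u) ∧ u * br 1 ≠ br u :=
    udlLe_lt_of_dlLt (.inl (by simp [hu]))
  have hlt2 {u : OpMon Z} (hu : u ≠ 1) : UdlLe (br 1 * u) (br u) ∧ br 1 * u ≠ br u :=
    udlLe_lt_of_dlLt (.inl (by rw [dagger_mul]; simp [hu]))
  refine isOperatedGSBasis_unary hle (fun u : Fin 2 → OpMon Z => u 0) _
    (good := fun u => u ≠ 1) (fun u => ⟨fun _ => u, rfl⟩) (fun u hu => ?_) (fun u hu => ?_) ?_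
  · obtain rfl : u = 1 := not_not.1 hu
    simp only [LinearMap.sub_apply, LinearMap.add_apply, LinearMap.smul_apply,
      LinearMap.mulRight_apply, LinearMap.mulLeft_apply, opBr_mon, ← mon_mul, mul_one, one_mul]
    module
  · simp only [LinearMap.sub_apply, LinearMap.add_apply, LinearMap.smul_apply,
      LinearMap.mulRight_apply, LinearMap.mulLeft_apply, opBr_mon, ← mon_mul]
    rw [show ∀ A B C : OpPoly k Z, A + B - C - A = B - C by intros; abel]
    exact sub_mem (Submodule.smul_mem _ _ (mon_mem_below (hlt1 hu)))
      (Submodule.smul_mem _ _ (mon_mem_below (hlt2 hu)))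
  · intro u hu p hp
    simp only [LinearMap.sub_apply, LinearMap.add_apply, LinearMap.smul_apply,
      LinearMap.mulRight_apply, LinearMap.mulLeft_apply]
    rw [show ∀ A B C : OpPoly k Z, A + B - C - A = B - C by intros; abel]
    exact sub_mem
      (Submodule.smul_mem _ _ (idealLE_le_idealLT hle (hlt1 hu) (mul_mem_idealLE hle hp _)))
      (Submodule.smul_mem _ _ (idealLE_le_idealLT hle (hlt2 hu) (mon_mul_mem_idealLE hle hp _)))

end Udl

/-! ### Compositions with $\lfloor1\rfloor-\lambda$ and the rule (U1'_b). -/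

section Unit

variable {k : Type*} [Field k] {Z : Type*} [LinearOrder Z] [WellFoundedLT Z]

/-- If `⌊1⌋ - a ∈ G` and all its occurrences in the leading monomial of `f ∈ G` yield trivial
inclusion compositions, then `f` and `⌊1⌋ - a` have only trivial compositions in any contexts. -/
theorem plugLin_sub_plugLin_mem_idealLT {G : Set (OpPoly k Z)} {a : k}
    (hh : mon k (br 1) - a • mon k 1 ∈ G) {f : OpPoly k Z} {l : OpMon Z} (hl1 : l ≠ 1)
    (hf : f ∈ G) (hl : f - mon k l ∈ below k UdlLe l)
    (hnest : ∀ q : StarWord Z, q.plug (br 1) = l →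
      f - q.plugLin k (mon k (br 1) - a • mon k 1) ∈ idealLT UdlLe G l)
    {q₁ q₂ : StarWord Z} (h : q₁.plug l = q₂.plug (br 1)) :
    q₁.plugLin k f - q₂.plugLin k (mon k (br 1) - a • mon k 1) ∈
      idealLT UdlLe G (q₁.plug l) := by
  have hle := udlLe_isMonomialOrder (Z := Z)
  have h1 : UdlLe (1 : OpMon Z) (br 1) ∧ (1 : OpMon Z) ≠ br 1 := ⟨hle.one_le _, (br_ne_one _).symm⟩
  have hh' : mon k (br 1) - a • mon k 1 ∈ idealLE UdlLe G (br 1) := by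
    refine mem_idealLE_of_sub_mem hle hh ?_
    rw [sub_sub_cancel_left]
    exact neg_mem (Submodule.smul_mem _ _ (mon_mem_below h1))
  rcases StarWord.plug_eq_plug_br hl1 h with ⟨q, h2, h3⟩ | ⟨r₁, r₂, h2, h3, h4⟩
  · rw [StarWord.plugLin_eq_comp h3, ← map_sub]
    exact plugLin_mem_idealLT hle q₁ (hnest q h2.symm)
  · rw [StarWord.plugLin_congr h3, StarWord.plugLin_congr h4, h3]
    -- Disjoint occurrences, with $h=\lfloor1\rfloor-a$. The difference equals $f-\bar f$ in the
    -- first hole with $h$ in the second, plus $a$ times $f$ in the first hole with $1$ in the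
    -- second; both are below $w$.
    have key : below k UdlLe l ≤ (idealLT UdlLe G ((r₁ (br 1)).plug l)).comap
        ((r₁ (br 1)).plugLin k - a • (r₁ 1).plugLin k) := by
      refine below_le fun u hu => ?_
      have := plugLin_mem_idealLE hle (r₂ u) hh'
      rw [← h2] at this
      have := idealLE_le_idealLT hle (hle.plug_lt (r₁ (br 1)) _ _ hu.1 hu.2) this
      simpa [h2] using this
    have key := Submodule.mem_comap.1 (key hl)
    have hfm : (r₁ 1).plugLin k f ∈ idealLT UdlLe G ((r₁ (br 1)).plug l) := by
      refine idealLE_le_idealLT hle ?_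
        (plugLin_mem_idealLE hle (r₁ 1) (mem_idealLE_of_sub_mem hle hf hl))
      rw [h2, h2]
      exact hle.plug_lt _ _ _ h1.1 h1.2
    convert add_mem key (Submodule.smul_mem _ a hfm) using 1
    simp only [map_sub, map_smul, StarWord.plugLin_mon, LinearMap.sub_apply,
      LinearMap.smul_apply, ← h2]
    module

theorem isGSOn_U1b (a : k) : IsGSOn (UdlLe (Z := Z)) {UDiff.U1b a} := by
  classical
  have hle := udlLe_isMonomialOrder (Z := Z)
  refine ⟨hle, ?_⟩
  rw [substSet_singleton]
  have h (u : Fin 2 → OpMon Z) : OpPoly.substLin k u (UDiff.U1b a) =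
      derivRule (a • mon k 1) (mon k (u 0)) (mon k (u 1)) := by
    simp only [UDiff.U1b, UDiff.x, UDiff.y, map_add, map_sub, map_smul, OpPoly.substLin_mon,
      subst_mul, subst_br, subst_var, derivRule_mon, mul_one]
  simp only [h]
  set G := Set.range fun u : Fin 2 → OpMon Z => derivRule (a • mon k 1) (mon k (u 0)) (mon k (u 1))
  have hd : (1 : OpMon Z).dagger.degP = 0 := by simp
  have hG0 (u v : OpMon Z) : derivRule (a • mon k 1) (mon k u) (mon k v) ∈ G := ⟨![u, v], by simp⟩
  -- the instances with a trivial argument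
  have hone_left (v : OpMon Z) : derivRule (a • mon k 1) (mon k 1) (mon k v) =
      (mon k (br 1) - a • mon k 1) * mon k v := by
    simp only [derivRule_mon, one_mul, sub_mul, smul_mul_assoc, ← mon_mul]
    abel
  have hone_right (u : OpMon Z) : derivRule (a • mon k 1) (mon k u) (mon k 1) =
      mon k u * (mon k (br 1) - a • mon k 1) := by
    simp only [derivRule_mon, mul_one, mul_sub, mul_smul_comm, ← mon_mul]
    abel
  have hh : mon k (br 1) - a • mon k 1 ∈ G := by
    have := hG0 1 1
    rwa [hone_left, mon_one, mul_one] at this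
  have hhl : mon k (br 1) - a • mon k 1 - mon k (br 1) ∈ below k UdlLe (br (1 : OpMon Z)) := by
    rw [sub_sub_cancel_left]
    exact neg_mem (Submodule.smul_mem _ _ (mon_mem_below ⟨hle.one_le _, (br_ne_one _).symm⟩))
  -- For `u = 1` the terms $\lfloor v\rfloor$ cancel, leaving $(\lfloor1\rfloor-a)v$ with leading
  -- monomial $\lfloor1\rfloor v$. For `v = 1` the generic formula $u\lfloor v\rfloor$ stays valid.
  let L (u v : OpMon Z) : OpMon Z := if u = 1 then br 1 * v else u * br v
  have hcases (u v : OpMon Z) : (u ≠ 1 ∧ v ≠ 1 ∧ L u v = u * br v) ∨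
      ∃ q : StarWord Z, L u v = q.plug (br 1) ∧
        derivRule (a • mon k 1) (mon k u) (mon k v) =
          q.plugLin k (mon k (br 1) - a • mon k 1) := by
    by_cases hu : u = 1
    · subst hu
      refine .inr ⟨.star v, by simp [L], ?_⟩
      rw [hone_left, StarWord.plugLin_eq_mul_id (a := 1) (b := v) (by simp), mon_one, one_mul]
    · by_cases hv : v = 1
      · subst hv
        refine .inr ⟨.lmul u (.star 1), by simp [L, hu], ?_⟩
        rw [hone_right, StarWord.plugLin_eq_mul_id (a := u) (b := 1) (by simp), mon_one, mul_one]
      · exact .inl ⟨hu, hv, if_neg hu⟩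
  have hlead (u v : OpMon Z) : derivRule (a • mon k 1) (mon k u) (mon k v) - mon k (L u v) ∈
      below k UdlLe (L u v) := by
    rcases hcases u v with ⟨hu, hv, hL⟩ | ⟨q, hL, hF⟩
    · rw [hL]
      exact derivRule_sub_mem_below a hd hu hv
    · rw [hL, hF, map_sub, StarWord.plugLin_mon, sub_sub_cancel_left, map_smul,
        StarWord.plugLin_mon]
      exact neg_mem (Submodule.smul_mem _ _ (mon_mem_below
        (hle.plug_lt q _ _ (hle.one_le _) (br_ne_one _).symm)))
  -- The bound $u\lfloor v\rfloor$ thus holds for all arguments, so the general intersection and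
  -- inclusion arguments may use degenerate instances freely.
  have hLle (u v : OpMon Z) : UdlLe (L u v) (u * br v) := by
    by_cases hu : u = 1
    · subst hu
      simp only [L, if_true, one_mul]
      by_cases hv : v = 1
      · subst hv
        simpa using hle.refl _
      · refine (udlLe_lt_of_dlLt (.inl ?_)).1
        rw [dagger_mul]
        simp [hv]
    · simpa only [L, if_neg hu] using hle.refl _
  have hG : IsDerivRule G a 1 :=
    ⟨hd, fun u v => idealLE_mono hle (hLle u v)
      (mem_idealLE_of_sub_mem hle (hG0 u v) (hlead u v))⟩
  -- Degenerate instances are $\lfloor1\rfloor-a$ in a context, so this one statement covers every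
  -- composition in which at least one of the two instances is degenerate.
  have hunit (u v : OpMon Z) (q₁ q₂ : StarWord Z) (h : q₁.plug (L u v) = q₂.plug (br 1)) :
      q₁.plugLin k (derivRule (a • mon k 1) (mon k u) (mon k v)) -
        q₂.plugLin k (mon k (br 1) - a • mon k 1) ∈ idealLT UdlLe G (q₁.plug (L u v)) := by
    rcases hcases u v with ⟨hu, hv, hL⟩ | ⟨q, hL, hF⟩
    · rw [hL] at h ⊢
      refine plugLin_sub_plugLin_mem_idealLT hh (fun h => hu (mul_eq_one.1 h).1) (hG0 u v)
        (hL ▸ hlead u v) (fun q hq => ?_) h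
      rcases StarWord.plug_eq_mul (br_ne_one _) hq with ⟨q', rfl, h2⟩ | ⟨q', h1, h2⟩ |
        ⟨b, s₁, s₂, s', h1, h2, h3, -⟩
      · rw [StarWord.plugLin_eq_mul (r := q') (a := 1) (b := br v) (by simpa using h2), mon_one,
          one_mul]
        exact hG.nested_left (br_ne_one _) hh hhl hv
      · rcases StarWord.plug_eq_br (br_ne_one _) h1 with ⟨h1, -⟩ | ⟨r, rfl, h3⟩
        · exact absurd (br_injective h1).symm hv
        · rw [StarWord.plugLin_eq_mul (r := q') (a := u) (b := 1) (by simpa using h2), mon_one,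
            mul_one, StarWord.plugLin_eq_opBr h3]
          exact hG.nested_right (br_ne_one _) hh hhl hu
      · have := congrArg breadth h3
        have := mt breadth_eq_zero.1 h1
        have := mt breadth_eq_zero.1 h2
        simp only [breadth_mul, breadth_br] at *
        omega
    · rw [hL, hF, ← StarWord.plugLin_eq_comp (q := q₁.comp q) (by simp), ← StarWord.plug_comp]
      rw [hL, ← StarWord.plug_comp] at h
      refine plugLin_sub_plugLin_mem_idealLT hh (br_ne_one _) hh hhl (fun q hq => ?_) h
      rcases StarWord.plug_eq_br (br_ne_one _) hq with ⟨-, h1⟩ | ⟨r, h1, -⟩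
      · rw [StarWord.plugLin_eq_self h1, sub_self]
        exact zero_mem _
      · exact absurd (StarWord.eq_one_of_plug_eq_one h1) (br_ne_one _)
  have hmul (p : OpPoly k Z) (b : OpMon Z) : p * mon k b = (StarWord.star b).plugLin k p := by
    rw [StarWord.plugLin_eq_mul_id (a := 1) (b := b) (by simp), mon_one, one_mul]
  have hmul' (p : OpPoly k Z) (b : OpMon Z) :
      mon k b * p = (StarWord.lmul b (.star 1)).plugLin k p := by
    rw [StarWord.plugLin_eq_mul_id (a := b) (b := 1) (by simp), mon_one, mul_one]
  refine isOperatedGSBasis_range hle (L := fun u => L (u 0) (u 1)) (good := fun _ => True)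
    (by simp) (fun u _ => hlead _ _) ?_ ?_
  · intro i j _ _ x y hxy hx hy hl
    rcases hcases (j 0) (j 1) with ⟨hj0, hj1, hLj⟩ | ⟨q, hLj, hFj⟩
    · rcases hcases (i 0) (i 1) with ⟨hi0, hi1, hLi⟩ | ⟨q, hLi, hFi⟩
      · rw [hLi, hLj] at hxy
        rw [hLj] at hl
        rw [hLi]
        exact hG.intersection' hi1 hj1 hxy hx hy hl
      · have := hunit (j 0) (j 1) (.lmul y (.star 1)) ((StarWord.star x).comp q)
          (by simp [← hLi, ← hxy])
        rw [← neg_mem_iff, neg_sub, hFi, hmul, hmul', ← StarWord.plugLin_eq_comp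
          (q := (StarWord.star x).comp q) (by simp), hxy]
        simpa using this
    · have := hunit (i 0) (i 1) (.star x) ((StarWord.lmul y (.star 1)).comp q)
        (by simp [← hLj, ← hxy])
      rw [hFj, hmul, hmul', ← StarWord.plugLin_eq_comp
        (q := (StarWord.lmul y (.star 1)).comp q) (by simp)]
      exact this
  · intro i j _ _ r hr
    rcases hcases (j 0) (j 1) with ⟨hj0, hj1, hLj⟩ | ⟨q, hLj, hFj⟩
    · rcases hcases (i 0) (i 1) with ⟨hi0, hi1, hLi⟩ | ⟨q, hLi, hFi⟩
      · rw [hLi, hLj] at hr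
        rw [hLi]
        exact hG.inclusion hi0 hi1 hj0 hj1 (hG0 _ _) hr
      · have := hunit (j 0) (j 1) r q (by rw [hr, hLi])
        rw [← neg_mem_iff, neg_sub, hFi, ← hr]
        exact this
    · have := hunit (i 0) (i 1) (.star 1) (r.comp q) (by simp [← hLj, hr])
      rw [hFj, ← StarWord.plugLin_eq_comp (q := r.comp q) (by simp)]
      rwa [← hmul, mon_one, mul_one, StarWord.plug_star, mul_one] at this

end Unit

end

theorem mainTheorem8 {k : Type*} [Field k] {Z : Type*} [LinearOrder Z] [WellFoundedLT Z] :
    -- (U1'_a)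
    (∀ a b c : k, a ^ 2 = a * b + c → IsGSOn (DbLe (Z := Z)) {UDiff.U1a a b c}) ∧
    -- (U1'_b) = (U5'_a)
    (∀ a : k, IsGSOn (UdlLe (Z := Z)) {UDiff.U1b a}) ∧
    -- (U1'_c) = (U2'_b) = (U6'_b)
    (∀ a : k, IsGSOn (DbLe (Z := Z)) {UDiff.U1c a}) ∧
    -- (U2'_a)
    (∀ a b : k, IsGSOn (DbLe (Z := Z)) {UDiff.U2a a b}) ∧
    -- (U3') = (U4') = (U6'_a)
    (∀ a : k, IsGSOn (UdlLe (Z := Z)) {UDiff.U3 a}) ∧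
    -- (U5'_b)
    IsGSOn (UdlLe (Z := Z)) {UDiff.U5b k} ∧
    -- (U5'_c) = (U6'_c)
    IsGSOn (DbLe (Z := Z)) {UDiff.U5c k} :=
  ⟨isGSOn_U1a, isGSOn_U1b, isGSOn_U1c, isGSOn_U2a, isGSOn_U3, isGSOn_U5b, isGSOn_U5c⟩
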